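/- A \emph{curve} in $\mathbb{R}^2$ is the image of a nondegenerate interval under a continuous map; it is \emph{locally rectifiable} if it has such a parametrization with finite length on every compact subinterval. For a family $\Gamma$ of curves in $\mathbb{R}^2$ and $p \ge 1$, the $p$-modulus is $$\mathrm{mod}_p(\Gamma) = \inf_{\rho} \int_{\mathbb{R}^2} \rho(x)^p \, dx \in [0,\infty],$$ where $dx$ is Lebesgue measure and the infimum is over all Borel functions $\rho : \mathbb{R}^2 \to [0,\infty]$ such that $\int_\gamma \rho \, d\mathcal{H}^1 \ge 1$ for every locally rectifiable $\gamma \in \Gamma$ (with $\inf\emptyset=\infty$); here $\mathcal{H}^1$ is one-dimensional Hausdorff measure. \textbf{Theorem.} For every $p > 3$ there is a constant $c_p > 0$, depending only on $p$, such that the following holds. Let $\Gamma$ be a family of curves in $\mathbb{R}^2$ that contains, for every $1$-Lipschitz function $f : [0,1] \to [0,1]$, an isometric copy $\iota(G_f)$ ($\iota$ an isometry of $\mathbb{R}^2$) of the graph $$G_f = \{(x,f(x)) : x \in [0,1]\}.$$ Then $\mathrm{mod}_p(\Gamma) \ge c_p$. In particular, if $\Gamma$ is a Moser family, that is, a family of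 curves that contains an isometric copy of every rectifiable curve in $\mathbb{R}^2$ of length one (a curve with a continuous parametrization by $[0,1]$ of length one), then also $\mathrm{mod}_p(\Gamma) \ge c_p$. -/

import Mathlib

open scoped ENNReal NNReal

/-- The Euclidean plane `ℝ²`, with the Euclidean distance and Lebesgue measure `volume`. -/
abbrev Plane : Type := EuclideanSpace ℝ (Fin 2)

/-- `γ` is a curve in the plane: the image of a nondegenerate interval (open, closed or half-open,
bounded or not) under a continuous map. -/
def IsCurve (γ : Set Plane) : Prop :=
  ∃ (I : Set ℝ) (φ : ℝ → Plane), I.OrdConnected ∧ I.Nontrivial ∧ ContinuousOn φ I ∧ φ '' I = γ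

/-- `γ` is a locally rectifiable curve: it has a continuous parametrization by a nondegenerate
interval whose restriction to each compact subinterval has finite length. -/
def IsLocallyRectifiableCurve (γ : Set Plane) : Prop :=
  ∃ (I : Set ℝ) (φ : ℝ → Plane), I.OrdConnected ∧ I.Nontrivial ∧ ContinuousOn φ I ∧
    LocallyBoundedVariationOn φ I ∧ φ '' I = γ

/-- `γ` is a rectifiable curve of length one: it has a continuous parametrization by `[0,1]` whose
length (the supremum of the lengths of inscribed polygons) is `1`. -/
def IsCurveOfLengthOne (γ : Set Plane) : Prop :=
  ∃ φ : ℝ → Plane, ContinuousOn φ (Set.Icc 0 1) ∧ eVariationOn φ (Set.Icc 0 1) = 1 ∧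
    φ '' Set.Icc 0 1 = γ

/-- The family `Γ` contains an isometric copy of the set `G`. -/
def ContainsIsometricCopy (Γ : Set (Set Plane)) (G : Set Plane) : Prop :=
  ∃ ι : Plane ≃ᵢ Plane, ι '' G ∈ Γ

/-- The functions `ρ : ℝ² → [0,∞]` admissible for the family `Γ`: Borel functions whose integral
with respect to one-dimensional Hausdorff measure is at least `1` over every locally rectifiable
member of `Γ`. -/
def admissible (Γ : Set (Set Plane)) : Set (Plane → ℝ≥0∞) :=
  {ρ | Measurable ρ ∧ ∀ γ ∈ Γ, IsLocallyRectifiableCurve γ →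
    1 ≤ ∫⁻ x in γ, ρ x ∂(MeasureTheory.Measure.hausdorffMeasure 1 : MeasureTheory.Measure Plane)}

/-- The `p`-modulus of the family `Γ` with respect to Lebesgue measure. -/
noncomputable def modulus (p : ℝ) (Γ : Set (Set Plane)) : ℝ≥0∞ :=
  ⨅ ρ ∈ admissible Γ, ∫⁻ x, ρ x ^ p ∂(MeasureTheory.volume : MeasureTheory.Measure Plane)

/-- The graph `{(x, f x) : x ∈ [0,1]}`. -/
def graphOverUnitInterval (f : ℝ → ℝ) : Set Plane :=
  (fun x : ℝ => !₂[x, f x]) '' Set.Icc 0 1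

/-- A Moser family: a family of curves containing an isometric copy of every rectifiable plane
curve of length one. -/
def IsMoserFamily (Γ : Set (Set Plane)) : Prop :=
  (∀ γ ∈ Γ, IsCurve γ) ∧ ∀ γ : Set Plane, IsCurveOfLengthOne γ → ContainsIsometricCopy Γ γ

open MeasureTheory ProbabilityTheory

/-! If `∫ ρ^p` is small, one 1-Lipschitz graph is built whose `ρ`-mass is small in every position at
once (`exists_graph_lintegral_lt`), so `ρ` is not admissible. Replacing `ρ` by a lower
semicontinuous lattice-periodic majorant leaves only isometries that send the origin into the unit
square.

The graph is a limit of graphs `F j` at scales `1/n`, where `n` is squared at each stage. The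
invariant `HasSlabBound` bounds the average mass in the strip of height `1/n` above every normalised
copy. To pass to height `h = n⁻²`, a random profile with values in `[0, a]`, `a + h = 1/n`, is
added. It runs through independent uniform points of a circle, which is then folded onto an
interval. On the circle every intermediate point of a random arc is again uniform
(`lintegral_arcPoint`), so at each abscissa the strip is moved to a uniform height and its expected
mass is at most `h/a` times the old mass.

One profile must serve all isometries. Even cells involve independent pairs of nodes, and so do odd
cells, so a Chernoff bound and a union bound over a net of polynomial size apply
(`exists_perturbation`). A cell has width about `1/n` up to a factor `2^j`, hence area about `n⁻³`,
and mass at most a constant times `n^(-3(1-1/p))` by Hölder. Relative to `h = n⁻²` this is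
`n^(-(1-3/p))`, which beats the logarithm of the net size exactly because `p > 3` (`error_le`). The
relative losses `1 + 2⁻ʲ` have a bounded product, and lower semicontinuity with Fatou carries the
bound to the limit graph. -/

/-! ### Exponential moments and a simultaneous Chernoff bound -/

theorem Real.exp_le_one_add_one_add_mul {y η : ℝ} (hy : 0 ≤ y) (hyη : y ≤ η) (hη : η ≤ 1) :
    Real.exp y ≤ 1 + (1 + η) * y := by
  have h := (abs_le.1 (Real.abs_exp_sub_one_sub_id_le (x := y)
    (by rw [abs_of_nonneg hy]; linarith))).2
  nlinarith

theorem lintegral_pi_prod_eq_prod {m : ℕ} {E : Type*} [MeasurableSpace E] (ν : Measure E)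
    [IsProbabilityMeasure ν] (F : Fin m → E → ℝ≥0∞) (hF : ∀ k, Measurable (F k)) :
    ∫⁻ ω : Fin m → E, ∏ k, F k (ω k) ∂(Measure.pi fun _ => ν) = ∏ k, ∫⁻ e, F k e ∂ν := by
  have hind : iIndepFun (fun k (ω : Fin m → E) => F k (ω k)) (Measure.pi fun _ => ν) :=
    iIndepFun_pi (fun k => (hF k).aemeasurable)
  have := lintegral_prod_eq_prod_lintegral_of_indepFun Finset.univ
    (fun k (ω : Fin m → E) => F k (ω k)) hind (fun k => (hF k).comp (measurable_pi_apply k))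
  rw [this]
  refine Finset.prod_congr rfl fun k _ => ?_
  exact (measurePreserving_eval (fun _ : Fin m => ν) k).lintegral_comp (hF k)

/-- The moment generating function of a random variable with values in `[0, M]`, normalised
by slightly more than its mean. -/
theorem lintegral_exp_sub_le_one {E : Type*} [MeasurableSpace E] (ν : Measure E)
    [IsProbabilityMeasure ν] {Y : E → ℝ≥0∞} (hY : Measurable Y) {M η : ℝ} (hM : 0 < M)
    (hη : 0 < η) (hη1 : η ≤ 1) (hYM : ∀ e, Y e ≤ ENNReal.ofReal M) :
    ∫⁻ e, ENNReal.ofReal (Real.exp (η / M * ((Y e).toReal - (1 + η) * (∫⁻ e, Y e ∂ν).toReal))) ∂ν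
      ≤ 1 := by
  set μ := (∫⁻ e, Y e ∂ν).toReal with hμ
  have hfin : ∫⁻ e, Y e ∂ν ≠ ∞ := by
    refine ne_top_of_le_ne_top (b := ENNReal.ofReal M) ENNReal.ofReal_ne_top ?_
    refine (lintegral_mono hYM).trans ?_
    simp
  have hμ0 : 0 ≤ μ := ENNReal.toReal_nonneg
  have hc : 0 ≤ η / M * (1 + η) := by positivity
  calc ∫⁻ e, ENNReal.ofReal (Real.exp (η / M * ((Y e).toReal - (1 + η) * μ))) ∂ν
      ≤ ∫⁻ e, ENNReal.ofReal (Real.exp (-(η / M * (1 + η) * μ))) *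
          (1 + ENNReal.ofReal (η / M * (1 + η)) * Y e) ∂ν := by
        refine lintegral_mono fun e => ?_
        have hYe : Y e ≠ ∞ := ne_top_of_le_ne_top ENNReal.ofReal_ne_top (hYM e)
        have h1 : (Y e).toReal ≤ M := ENNReal.toReal_le_of_le_ofReal hM.le (hYM e)
        have h0 : 0 ≤ (Y e).toReal := ENNReal.toReal_nonneg
        have h2 : η / M * (Y e).toReal ≤ η := by
          calc η / M * (Y e).toReal ≤ η / M * M := by gcongr
            _ = η := by field_simp
        have h3 := Real.exp_le_one_add_one_add_mul (by positivity) h2 hη1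
        have h4 : 1 + ENNReal.ofReal (η / M * (1 + η)) * Y e =
            ENNReal.ofReal (1 + η / M * (1 + η) * (Y e).toReal) := by
          rw [ENNReal.ofReal_add one_pos.le (by positivity), ENNReal.ofReal_mul hc,
            ENNReal.ofReal_toReal hYe, ENNReal.ofReal_one]
        rw [h4, ← ENNReal.ofReal_mul (Real.exp_pos _).le]
        refine ENNReal.ofReal_le_ofReal ?_
        rw [show η / M * ((Y e).toReal - (1 + η) * μ) =
          -(η / M * (1 + η) * μ) + η / M * (Y e).toReal by ring, Real.exp_add]
        gcongr
        linarith
    _ = ENNReal.ofReal (Real.exp (-(η / M * (1 + η) * μ))) *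
          ENNReal.ofReal (1 + η / M * (1 + η) * μ) := by
        rw [lintegral_const_mul _ (by fun_prop), lintegral_add_left (by fun_prop),
          lintegral_const_mul _ hY, ENNReal.ofReal_add one_pos.le (by positivity),
          ENNReal.ofReal_mul hc, hμ, ENNReal.ofReal_toReal hfin]
        simp
    _ ≤ 1 := by
        rw [← ENNReal.ofReal_mul (Real.exp_pos _).le, ← ENNReal.ofReal_one]
        refine ENNReal.ofReal_le_ofReal ?_
        have := Real.add_one_le_exp (η / M * (1 + η) * μ)
        rw [Real.exp_neg, inv_mul_le_iff₀ (Real.exp_pos _)]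
        linarith

theorem lintegral_pi_exp_sub_le_one {m : ℕ} {E : Type*} [MeasurableSpace E] (ν : Measure E)
    [IsProbabilityMeasure ν] {Y : Fin m → E → ℝ≥0∞} (hY : ∀ k, Measurable (Y k)) {M η : ℝ}
    (hM : 0 < M) (hη : 0 < η) (hη1 : η ≤ 1) (hYM : ∀ k e, Y k e ≤ ENNReal.ofReal M) :
    ∫⁻ ω : Fin m → E, ENNReal.ofReal (Real.exp (η / M * ((∑ k, Y k (ω k)).toReal -
      (1 + η) * (∑ k, ∫⁻ e, Y k e ∂ν).toReal))) ∂(Measure.pi fun _ => ν) ≤ 1 := by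
  have hfin : ∀ k e, Y k e ≠ ∞ := fun k e =>
    ne_top_of_le_ne_top ENNReal.ofReal_ne_top (hYM k e)
  have hfin' : ∀ k, ∫⁻ e, Y k e ∂ν ≠ ∞ := fun k => by
    refine ne_top_of_le_ne_top (b := ENNReal.ofReal M) ENNReal.ofReal_ne_top ?_
    refine (lintegral_mono (hYM k)).trans ?_
    simp
  have key : ∀ ω : Fin m → E, ENNReal.ofReal (Real.exp (η / M * ((∑ k, Y k (ω k)).toReal -
      (1 + η) * (∑ k, ∫⁻ e, Y k e ∂ν).toReal))) = ∏ k, ENNReal.ofReal (Real.exp (η / M *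
        ((Y k (ω k)).toReal - (1 + η) * (∫⁻ e, Y k e ∂ν).toReal))) := by
    intro ω
    rw [← ENNReal.ofReal_prod_of_nonneg (fun _ _ => (Real.exp_pos _).le), ← Real.exp_sum,
      ← Finset.mul_sum, Finset.sum_sub_distrib, ← Finset.mul_sum,
      ENNReal.toReal_sum (fun k _ => hfin k _), ENNReal.toReal_sum (fun k _ => hfin' k)]
  simp_rw [key]
  rw [lintegral_pi_prod_eq_prod ν (fun k e => ENNReal.ofReal (Real.exp (η / M *
        ((Y k e).toReal - (1 + η) * (∫⁻ e, Y k e ∂ν).toReal)))) (fun k => by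
          have := hY k
          fun_prop)]
  exact Finset.prod_le_one (fun _ _ => zero_le) fun k _ =>
    lintegral_exp_sub_le_one ν (hY k) hM hη hη1 (hYM k)

theorem le_of_ofReal_exp_le {S T : ℝ≥0∞} (hS : S ≠ ∞) (hT : T ≠ ∞) {M η N : ℝ} (hM : 0 < M)
    (hη : 0 < η) (hN : 1 ≤ N)
    (h : ENNReal.ofReal (Real.exp (η / M * (S.toReal - (1 + η) * T.toReal))) ≤ ENNReal.ofReal N) :
    S ≤ ENNReal.ofReal (1 + η) * T + ENNReal.ofReal (M / η * Real.log N) := by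
  have hlog := Real.log_nonneg hN
  rw [ENNReal.ofReal_le_ofReal_iff (by linarith), ← Real.le_log_iff_exp_le (by linarith)] at h
  have h' : S.toReal ≤ (1 + η) * T.toReal + M / η * Real.log N := by
    have h2 : M / η * (η / M * (S.toReal - (1 + η) * T.toReal)) ≤ M / η * Real.log N := by gcongr
    have h3 : M / η * (η / M * (S.toReal - (1 + η) * T.toReal)) = S.toReal - (1 + η) * T.toReal := by
      field_simp
    linarith
  rw [← ENNReal.ofReal_toReal hS]
  refine (ENNReal.ofReal_le_ofReal h').trans_eq ?_
  rw [ENNReal.ofReal_add (by positivity) (by positivity), ENNReal.ofReal_mul (by positivity),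
    ENNReal.ofReal_toReal hT]

/-- Simultaneous Chernoff bound for two interleaved families of independent variables: the
variables `Y j k (α k, β k)` are independent in `k`, and so are `Z j k (β k, α (σ k))`. -/
theorem exists_forall_sum_le {m : ℕ} {C : Type*} [MeasurableSpace C] (ν : Measure C)
    [IsProbabilityMeasure ν] (σ : Equiv.Perm (Fin m)) {J : Type*} [Fintype J] [Nonempty J]
    {Y Z : J → Fin m → C × C → ℝ≥0∞} (hY : ∀ j k, Measurable (Y j k))
    (hZ : ∀ j k, Measurable (Z j k)) {M η : ℝ} (hM : 0 < M) (hη : 0 < η) (hη1 : η ≤ 1)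
    (hYM : ∀ j k e, Y j k e ≤ ENNReal.ofReal M) (hZM : ∀ j k e, Z j k e ≤ ENNReal.ofReal M) :
    ∃ α β : Fin m → C, ∀ j, ∑ k, Y j k (α k, β k) + ∑ k, Z j k (β k, α (σ k)) ≤
      ENNReal.ofReal (1 + η) *
        (∑ k, ∫⁻ e, Y j k e ∂(ν.prod ν) + ∑ k, ∫⁻ e, Z j k e ∂(ν.prod ν)) +
      ENNReal.ofReal (2 * (M / η * Real.log (2 * Fintype.card J))) := by
  set P : Measure (Fin m → C) := Measure.pi fun _ => ν
  set Φ : (Fin m → C × C → ℝ≥0∞) → (Fin m → C × C) → ℝ≥0∞ := fun W ω =>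
    ENNReal.ofReal (Real.exp (η / M * ((∑ k, W k (ω k)).toReal -
      (1 + η) * (∑ k, ∫⁻ e, W k e ∂(ν.prod ν)).toReal))) with hΦ
  have hΦm : ∀ W : Fin m → C × C → ℝ≥0∞, (∀ k, Measurable (W k)) → Measurable (Φ W) := by
    intro W hW
    have : Measurable fun ω : Fin m → C × C => ∑ k, W k (ω k) :=
      Finset.measurable_sum _ fun k _ => (hW k).comp (measurable_pi_apply k)
    simp only [hΦ]
    fun_prop
  have hpair : MeasurePreserving (fun q : (Fin m → C) × (Fin m → C) => fun k => (q.1 k, q.2 k))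
      (P.prod P) (Measure.pi fun _ => ν.prod ν) :=
    (measurePreserving_arrowProdEquivProdArrow C C (Fin m) (fun _ => ν) (fun _ => ν)).symm
  have hperm : MeasurePreserving (fun a : Fin m → C => fun k => a (σ k)) P P := by
    have := (measurePreserving_piCongrLeft (fun _ : Fin m => ν) σ).symm
    convert! this using 1
  -- Permuting the coordinates of `α` preserves the product law, so the shifted pairs are also
  -- independent and uniform.
  have hpair' : MeasurePreserving
      (fun q : (Fin m → C) × (Fin m → C) => fun k => (q.2 k, q.1 (σ k)))
      (P.prod P) (Measure.pi fun _ => ν.prod ν) := by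
    have h1 : MeasurePreserving (Prod.swap : (Fin m → C) × (Fin m → C) → _) (P.prod P) (P.prod P) :=
      Measure.measurePreserving_swap
    exact hpair.comp (((MeasurePreserving.id P).prod hperm).comp h1)
  have hYint : ∀ j, ∫⁻ q, Φ (Y j) (fun k => (q.1 k, q.2 k)) ∂(P.prod P) ≤ 1 := fun j => by
    rw [hpair.lintegral_comp (hΦm _ (hY j))]
    exact lintegral_pi_exp_sub_le_one _ (hY j) hM hη hη1 (hYM j)
  have hZint : ∀ j, ∫⁻ q, Φ (Z j) (fun k => (q.2 k, q.1 (σ k))) ∂(P.prod P) ≤ 1 := fun j => by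
    rw [hpair'.lintegral_comp (hΦm _ (hZ j))]
    exact lintegral_pi_exp_sub_le_one _ (hZ j) hM hη hη1 (hZM j)
  have hYm : ∀ j, Measurable fun q : (Fin m → C) × (Fin m → C) =>
      Φ (Y j) (fun k => (q.1 k, q.2 k)) := fun j => (hΦm _ (hY j)).comp hpair.measurable
  have hZm : ∀ j, Measurable fun q : (Fin m → C) × (Fin m → C) =>
      Φ (Z j) (fun k => (q.2 k, q.1 (σ k))) := fun j => (hΦm _ (hZ j)).comp hpair'.measurable
  have hm : Measurable fun q : (Fin m → C) × (Fin m → C) =>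
      ∑ j, (Φ (Y j) (fun k => (q.1 k, q.2 k)) + Φ (Z j) (fun k => (q.2 k, q.1 (σ k)))) :=
    Finset.measurable_sum _ fun j _ => (hYm j).add (hZm j)
  -- Union bound: some sample does not exceed the mean of the sum, which is at most `2 * card J`;
  -- all terms being nonnegative, each obeys the same bound.
  obtain ⟨⟨α, β⟩, hq⟩ := exists_le_lintegral (μ := P.prod P) hm.aemeasurable
  have hle : ∫⁻ q, ∑ j, (Φ (Y j) (fun k => (q.1 k, q.2 k)) + Φ (Z j) (fun k => (q.2 k, q.1 (σ k))))
      ∂(P.prod P) ≤ ENNReal.ofReal (2 * Fintype.card J) := by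
    rw [lintegral_finsetSum]
    swap
    · exact fun j _ => (hYm j).add (hZm j)
    calc _ ≤ ∑ j : J, (2 : ℝ≥0∞) := Finset.sum_le_sum fun j _ => by
          rw [lintegral_add_left (hYm j), ← one_add_one_eq_two]
          exact add_le_add (hYint j) (hZint j)
      _ = _ := by
          rw [ENNReal.ofReal_mul (by norm_num)]
          simp [mul_comm]
  have hcard : (1 : ℝ) ≤ 2 * Fintype.card J := by
    have : (1 : ℝ) ≤ Fintype.card J := by exact_mod_cast Fintype.card_pos
    linarith
  have hfin : ∀ (W : Fin m → C × C → ℝ≥0∞), (∀ k e, W k e ≤ ENNReal.ofReal M) →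
      ∀ ω : Fin m → C × C, ∑ k, W k (ω k) ≠ ∞ := fun W hW ω =>
    ENNReal.sum_ne_top.2 fun k _ => ne_top_of_le_ne_top ENNReal.ofReal_ne_top (hW k _)
  have hfin' : ∀ (W : Fin m → C × C → ℝ≥0∞), (∀ k e, W k e ≤ ENNReal.ofReal M) →
      ∑ k, ∫⁻ e, W k e ∂(ν.prod ν) ≠ ∞ := fun W hW =>
    ENNReal.sum_ne_top.2 fun k _ => by
      refine ne_top_of_le_ne_top (b := ENNReal.ofReal M) ENNReal.ofReal_ne_top ?_
      refine (lintegral_mono (hW k)).trans ?_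
      simp
  refine ⟨α, β, fun j => ?_⟩
  have hj := (Finset.single_le_sum (f := fun j => Φ (Y j) (fun k => (α k, β k)) +
    Φ (Z j) (fun k => (β k, α (σ k)))) (fun _ _ => zero_le) (Finset.mem_univ j)).trans
      (hq.trans hle)
  have h1 := le_of_ofReal_exp_le (hfin (Y j) (hYM j) _) (hfin' _ (hYM j)) hM hη hcard
    (le_self_add.trans hj)
  have h2 := le_of_ofReal_exp_le (hfin (Z j) (hZM j) _) (hfin' _ (hZM j)) hM hη hcard
    (le_add_self.trans hj)
  have hlog := Real.log_nonneg hcard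
  refine (add_le_add h1 h2).trans_eq ?_
  have hpos : 0 ≤ M / η * Real.log (2 * Fintype.card J) := by positivity
  rw [two_mul (M / η * _), ENNReal.ofReal_add hpos hpos]
  ring

/-! ### Random paths on the circle with uniform marginals -/

/-- The representative in `[0,1)` of a point of the circle. -/
noncomputable def circleLift (c : UnitAddCircle) : ℝ := (AddCircle.equivIco 1 0 c : ℝ)

theorem circleLift_nonneg (c : UnitAddCircle) : 0 ≤ circleLift c :=
  (AddCircle.equivIco 1 0 c).2.1

theorem circleLift_le_one (c : UnitAddCircle) : circleLift c ≤ 1 := by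
  have := (AddCircle.equivIco 1 0 c).2.2
  simp only [zero_add] at this
  exact this.le

theorem coe_circleLift (c : UnitAddCircle) : (circleLift c : UnitAddCircle) = c :=
  (AddCircle.equivIco 1 0).symm_apply_apply c

theorem measurable_circleLift : Measurable circleLift :=
  measurable_subtype_coe.comp (AddCircle.measurableEquivIco 1 0).measurable

/-- The continuous function that vanishes before `k`, equals `1` after `k + 1` and is affine in
between. -/
noncomputable def ramp (k : ℕ) (s : ℝ) : ℝ := max 0 (min 1 (s - k))

theorem ramp_mono (k : ℕ) : Monotone (ramp k) := fun s t h => by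
  unfold ramp
  gcongr

theorem sum_ramp (n : ℕ) (s : ℝ) : ∑ k ∈ Finset.range n, ramp k s = max 0 (min (n : ℝ) s) := by
  induction n with
  | zero => simp
  | succ n ih =>
    rw [Finset.sum_range_succ, ih]
    unfold ramp
    have hn : (0 : ℝ) ≤ n := Nat.cast_nonneg n
    push_cast
    simp only [max_def, min_def]
    split_ifs <;> linarith

/-- The path in the circle that moves in the positive direction from `ν k` to `ν (k + 1)`
during `[k, k + 1]`, for `k < n`. -/
noncomputable def circlePath (n : ℕ) (ν : ℕ → UnitAddCircle) (s : ℝ) : UnitAddCircle :=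
  ν 0 + ((∑ k ∈ Finset.range n, circleLift (ν (k + 1) - ν k) * ramp k s : ℝ) : UnitAddCircle)

/-- The point that divides the positive arc from `q.1` to `q.2` in the proportion `t`. -/
noncomputable def arcPoint (t : ℝ) (q : UnitAddCircle × UnitAddCircle) : UnitAddCircle :=
  q.1 + ((t * circleLift (q.2 - q.1) : ℝ) : UnitAddCircle)

/-- The lift is a combination of ramps with coefficients in `[0,1]`, so it increases no faster than
the sum of the ramps, which is `s` clamped to `[0, n]`. -/
theorem lipschitzWith_circlePath (n : ℕ) (ν : ℕ → UnitAddCircle) :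
    LipschitzWith 1 (circlePath n ν) := by
  have key : ∀ s t : ℝ, s ≤ t → dist (circlePath n ν s) (circlePath n ν t) ≤ dist s t := by
    intro s t hst
    rw [dist_comm, dist_comm s, circlePath, circlePath, dist_add_left, dist_eq_norm,
      ← AddCircle.coe_sub]
    refine (QuotientAddGroup.norm_mk_le_norm (S := AddSubgroup.zmultiples (1 : ℝ))).trans ?_
    rw [← Finset.sum_sub_distrib, Real.norm_eq_abs, abs_of_nonneg, Real.dist_eq,
      abs_of_nonneg (by linarith)]
    · calc ∑ k ∈ Finset.range n, (circleLift (ν (k + 1) - ν k) * ramp k t -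
            circleLift (ν (k + 1) - ν k) * ramp k s)
          ≤ ∑ k ∈ Finset.range n, (ramp k t - ramp k s) := Finset.sum_le_sum fun k _ => by
            rw [← mul_sub]
            exact mul_le_of_le_one_left (sub_nonneg.2 (ramp_mono k hst)) (circleLift_le_one _)
        _ ≤ t - s := by
            rw [Finset.sum_sub_distrib, sum_ramp, sum_ramp]
            have hn : (0 : ℝ) ≤ n := Nat.cast_nonneg n
            simp only [max_def, min_def]
            split_ifs <;> linarith
    · refine Finset.sum_nonneg fun k _ => ?_
      rw [← mul_sub]
      exact mul_nonneg (circleLift_nonneg _) (sub_nonneg.2 (ramp_mono k hst))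
  refine LipschitzWith.of_dist_le_mul fun s t => ?_
  rw [NNReal.coe_one, one_mul]
  rcases le_total s t with h | h
  · exact key s t h
  · rw [dist_comm, dist_comm s]
    exact key t s h

theorem circlePath_eq_arcPoint {n : ℕ} (ν : ℕ → UnitAddCircle) {k : ℕ} (hk : k < n) {s : ℝ}
    (hs : s ∈ Set.Icc (k : ℝ) (k + 1)) :
    circlePath n ν s = arcPoint (s - k) (ν k, ν (k + 1)) := by
  have hsum : ∑ i ∈ Finset.range n, circleLift (ν (i + 1) - ν i) * ramp i s =
      ∑ i ∈ Finset.range k, circleLift (ν (i + 1) - ν i) +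
        (s - k) * circleLift (ν (k + 1) - ν k) := by
    have hsub : Finset.range (k + 1) ⊆ Finset.range n := Finset.range_subset_range.2 hk
    rw [← Finset.sum_subset hsub, Finset.sum_range_succ]
    · congr 1
      · refine Finset.sum_congr rfl fun i hi => ?_
        have : (i : ℝ) + 1 ≤ k := by exact_mod_cast Finset.mem_range.1 hi
        rw [ramp, min_eq_left (by linarith [hs.1]), max_eq_right zero_le_one, mul_one]
      · rw [ramp, min_eq_right (by linarith [hs.2]), max_eq_right (by linarith [hs.1]), mul_comm]
    · intro i _ hi
      have : (k : ℝ) + 1 ≤ i := by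
        rw [Finset.mem_range, not_lt] at hi
        exact_mod_cast hi
      rw [ramp, min_eq_right (by linarith [hs.2]), max_eq_left (by linarith [hs.2]), mul_zero]
  have htel : ∀ j : ℕ, ν 0 + ((∑ i ∈ Finset.range j, circleLift (ν (i + 1) - ν i) : ℝ) :
      UnitAddCircle) = ν j := by
    intro j
    induction j with
    | zero => simp
    | succ j ih =>
      rw [Finset.sum_range_succ, AddCircle.coe_add, ← add_assoc, ih, coe_circleLift]
      abel
  rw [circlePath, hsum, AddCircle.coe_add, ← add_assoc, htel, arcPoint]

theorem measurable_arcPoint :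
    Measurable fun z : ℝ × (UnitAddCircle × UnitAddCircle) => arcPoint z.1 z.2 := by
  unfold arcPoint
  have h1 : Measurable fun z : ℝ × (UnitAddCircle × UnitAddCircle) =>
      z.1 * circleLift (z.2.2 - z.2.1) :=
    measurable_fst.mul (measurable_circleLift.comp (by fun_prop))
  exact (by fun_prop : Measurable fun z : ℝ × (UnitAddCircle × UnitAddCircle) => z.2.1).add
    (AddCircle.measurable_mk'.comp h1)

/-- For independent uniform endpoints, every division point of the arc is uniform. -/
theorem lintegral_arcPoint (t : ℝ) {F : UnitAddCircle → ℝ≥0∞} (hF : Measurable F) :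
    ∫⁻ q : UnitAddCircle × UnitAddCircle, F (arcPoint t q) ∂(volume.prod volume) =
      ∫⁻ θ, F θ := by
  have hm : Measurable fun q : UnitAddCircle × UnitAddCircle => F (arcPoint t q) :=
    hF.comp (measurable_arcPoint.comp (measurable_const.prodMk measurable_id))
  rw [lintegral_prod _ hm.aemeasurable]
  -- With `y = x + c`, the displacement depends on `c` alone; integrating in `x` first, translation
  -- invariance removes it.
  have h1 : ∀ x : UnitAddCircle, ∫⁻ y, F (arcPoint t (x, y)) =
      ∫⁻ c, F (x + ((t * circleLift c : ℝ) : UnitAddCircle)) := fun x =>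
    lintegral_sub_right_eq_self
      (fun c : UnitAddCircle => F (x + ((t * circleLift c : ℝ) : UnitAddCircle))) x
  simp_rw [h1]
  rw [lintegral_lintegral_swap]
  · simp_rw [lintegral_add_right_eq_self F]
    simp
  · refine Measurable.aemeasurable (hF.comp ?_)
    exact measurable_fst.add (AddCircle.measurable_mk'.comp
      ((measurable_circleLift.comp measurable_snd).const_mul t))

theorem lintegral_comp_mul_add {F : ℝ → ℝ≥0∞} (hF : Measurable F) {b : ℝ} (hb : b ≠ 0) (u : ℝ) :
    ∫⁻ x : ℝ, F (b * x + u) = ENNReal.ofReal |b|⁻¹ * ∫⁻ w, F w := by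
  have h1 : ∫⁻ x : ℝ, F (x + u) = ∫⁻ w, F w := lintegral_add_right_eq_self F u
  have hm : Measurable fun x => F (x + u) := by fun_prop
  have h2 := Real.smul_map_volume_mul_left hb
  have h3 : ENNReal.ofReal |b| * ∫⁻ x : ℝ, F (b * x + u) = ∫⁻ w, F w := by
    rw [← h1]
    conv_rhs => rw [← h2]
    rw [lintegral_smul_measure, lintegral_map hm (by fun_prop), smul_eq_mul]
  rw [← h3, ← mul_assoc, ← ENNReal.ofReal_mul (by positivity), inv_mul_cancel₀ (by positivity)]
  simp

/-- For uniform `θ`, `2a‖θ‖` is uniform on `[0,a]`, so for each `u` the shifted height has density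
at most `1/a` on `[0, a+h]`; the two halves of the circle contribute `1/(2a)` each. -/
theorem lintegral_circle_norm_le {φ : ℝ → ℝ≥0∞} (hφ : Measurable φ) {a h : ℝ} (ha : 0 < a)
    (hh : 0 ≤ h) :
    ∫⁻ θ : UnitAddCircle, ∫⁻ u in Set.Icc 0 h, φ (2 * a * ‖θ‖ + u) ≤
      ENNReal.ofReal (h / a) * ∫⁻ w in Set.Icc 0 (a + h), φ w := by
  set F : ℝ → ℝ≥0∞ := (Set.Icc 0 (a + h)).indicator φ with hFdef
  have hF : Measurable F := hφ.indicator measurableSet_Icc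
  have hFint : ∫⁻ w, F w = ∫⁻ w in Set.Icc 0 (a + h), φ w := lintegral_indicator measurableSet_Icc _
  rw [lintegral_lintegral_swap (by fun_prop)]
  have hu : ∀ u ∈ Set.Icc 0 h, ∫⁻ θ : UnitAddCircle, φ (2 * a * ‖θ‖ + u) ≤
      ENNReal.ofReal a⁻¹ * ∫⁻ w, F w := by
    intro u hu
    rw [← UnitAddCircle.lintegral_preimage (-(1 / 2))]
    have hle : ∀ x ∈ Set.Ioc (-(1 / 2) : ℝ) (-(1 / 2) + 1),
        φ (2 * a * ‖(x : UnitAddCircle)‖ + u) ≤ F (2 * a * x + u) + F (-(2 * a) * x + u) := by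
      intro x hx
      have hx1 : |x| ≤ 1 / 2 := abs_le.2 ⟨hx.1.le, by linarith [hx.2]⟩
      have hnorm : ‖(x : UnitAddCircle)‖ = |x| :=
        (AddCircle.norm_coe_eq_abs_iff 1 one_ne_zero).2 (by simpa using hx1)
      have hmem : 2 * a * |x| + u ∈ Set.Icc 0 (a + h) :=
        ⟨by have := hu.1; positivity, by nlinarith [hu.2]⟩
      have hval : F (2 * a * |x| + u) = φ (2 * a * |x| + u) := Set.indicator_of_mem hmem _
      rw [hnorm, ← hval]
      rcases abs_cases x with ⟨h1, _⟩ | ⟨h1, _⟩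
      · rw [h1]
        exact le_self_add
      · rw [h1, show 2 * a * -x + u = -(2 * a) * x + u by ring]
        exact le_add_self
    calc _ ≤ ∫⁻ x in Set.Ioc (-(1 / 2) : ℝ) (-(1 / 2) + 1),
          (F (2 * a * x + u) + F (-(2 * a) * x + u)) :=
          setLIntegral_mono (by fun_prop) hle
      _ ≤ ∫⁻ x, (F (2 * a * x + u) + F (-(2 * a) * x + u)) := setLIntegral_le_lintegral _ _
      _ = _ := by
          rw [lintegral_add_left (by fun_prop), lintegral_comp_mul_add hF (by positivity),
            lintegral_comp_mul_add hF (by simp [ha.ne']), abs_neg, ← add_mul,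
            ← ENNReal.ofReal_add (by positivity) (by positivity), abs_of_pos (by positivity)]
          congr 2
          field_simp
          norm_num
  calc _ ≤ ∫⁻ u in Set.Icc 0 h, ENNReal.ofReal a⁻¹ * ∫⁻ w, F w :=
        setLIntegral_mono measurable_const hu
    _ = _ := by
        rw [setLIntegral_const, Real.volume_Icc, hFint, sub_zero, mul_comm, ← mul_assoc,
          ← ENNReal.ofReal_mul hh, div_eq_mul_inv]

/-! ### Area-preserving charts along congruent copies, and Hölder's inequality -/

theorem IsometryEquiv.measurePreserving_volume_plane (ι : Plane ≃ᵢ Plane) :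
    MeasurePreserving ι volume volume := by
  have h1 := ι.toRealLinearIsometryEquiv.measurePreserving
  have h2 : MeasurePreserving (fun x : Plane => x + ι 0) volume volume :=
    measurePreserving_add_right volume (ι 0)
  have h3 : ⇑ι = (fun x => x + ι 0) ∘ ι.toRealLinearIsometryEquiv := by
    funext x
    simp
  rw [h3]
  exact h2.comp h1

theorem plane_norm_le (z : Plane) : ‖z‖ ≤ |z 0| + |z 1| := by
  rw [EuclideanSpace.norm_eq, Fin.sum_univ_two]
  refine Real.sqrt_le_iff.2 ⟨by positivity, ?_⟩
  simp only [Real.norm_eq_abs]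
  nlinarith [abs_nonneg (z 0), abs_nonneg (z 1)]

theorem plane_abs_coord_le (z : Plane) (i : Fin 2) : |z i| ≤ ‖z‖ := by
  simpa using PiLp.norm_apply_le z i

/-- The chart of the plane around the congruent copy by `ι` of the graph of `f`: the first
coordinate runs along the graph, the second one is the height above it. -/
noncomputable def slab (ι : Plane ≃ᵢ Plane) (f : ℝ → ℝ) (z : ℝ × ℝ) : Plane :=
  ι !₂[z.1, f z.1 + z.2]

theorem measurePreserving_slab (ι : Plane ≃ᵢ Plane) {f : ℝ → ℝ} (hf : Measurable f) :
    MeasurePreserving (slab ι f) volume volume := by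
  have h1 : MeasurePreserving (fun z : ℝ × ℝ => (z.1, f z.1 + z.2)) volume volume :=
    (MeasurePreserving.id volume).skew_product (g := fun x u => f x + u) (by fun_prop)
      (Filter.Eventually.of_forall fun x => map_add_left_eq_self volume (f x))
  have h2 := (volume_preserving_finTwoArrow ℝ).symm
  have h3 := PiLp.volume_preserving_toLp (Fin 2)
  exact ι.measurePreserving_volume_plane.comp (h3.comp (h2.comp h1))

/-- The origin is sent to the half-open unit square. -/
def IsNormalized (ι : Plane ≃ᵢ Plane) : Prop := ∀ i, ι 0 i ∈ Set.Ico (0 : ℝ) 1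

theorem IsNormalized.norm_le {ι : Plane ≃ᵢ Plane} (hι : IsNormalized ι) : ‖ι 0‖ ≤ 2 := by
  refine (plane_norm_le _).trans ?_
  rw [abs_of_nonneg (hι 0).1, abs_of_nonneg (hι 1).1]
  linarith [(hι 0).2, (hι 1).2]

theorem slab_mem_ball {ι : Plane ≃ᵢ Plane} (hι : IsNormalized ι) {f : ℝ → ℝ}
    (hf : ∀ x, f x ∈ Set.Icc (0 : ℝ) 1) {z : ℝ × ℝ}
    (hz : z ∈ Set.Icc (-1 : ℝ) 2 ×ˢ Set.Icc (-1 : ℝ) 2) :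
    slab ι f z ∈ Metric.ball (0 : Plane) 10 := by
  rw [mem_ball_zero_iff]
  obtain ⟨⟨h1, h2⟩, h3, h4⟩ := hz
  have hfz := hf z.1
  have hw : ‖(!₂[z.1, f z.1 + z.2] : Plane)‖ ≤ 5 := by
    refine (plane_norm_le _).trans ?_
    have e1 : |z.1| ≤ 2 := abs_le.2 ⟨by linarith, h2⟩
    have e2 : |f z.1 + z.2| ≤ 3 := abs_le.2 ⟨by linarith [hfz.1], by linarith [hfz.2]⟩
    simpa using (by linarith : |z.1| + |f z.1 + z.2| ≤ 5)
  have hd : ‖ι !₂[z.1, f z.1 + z.2] - ι 0‖ ≤ 5 := by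
    rw [← dist_eq_norm, ι.dist_eq, dist_zero_right]
    exact hw
  have := norm_le_norm_add_norm_sub' (ι !₂[z.1, f z.1 + z.2]) (ι 0)
  rw [slab]
  linarith [hι.norm_le]

theorem setLIntegral_le_rpow_mul {X : Type*} [MeasurableSpace X] {μ : Measure X} {F : X → ℝ≥0∞}
    (hF : Measurable F) {p : ℝ} (hp : 1 < p) (S : Set X) :
    ∫⁻ z in S, F z ∂μ ≤ (∫⁻ z in S, F z ^ p ∂μ) ^ (1 / p) * μ S ^ (1 - 1 / p) := by
  have hpq := Real.HolderConjugate.conjExponent hp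
  have h := ENNReal.lintegral_mul_le_Lp_mul_Lq (μ.restrict S) hpq hF.aemeasurable
    (aemeasurable_const (b := (1 : ℝ≥0∞)))
  simp only [Pi.mul_apply, mul_one, ENNReal.one_rpow, lintegral_one,
    Measure.restrict_apply_univ] at h
  rwa [show 1 / p.conjExponent = 1 - 1 / p by
    rw [one_div, one_div, ← hpq.one_sub_inv]] at h

/-- The `L^p` norm of `ρ` over a large disc is at most `κ`. -/
def HasLocalLpBound (p κ : ℝ) (ρ : Plane → ℝ≥0∞) : Prop :=
  (∫⁻ x in Metric.ball (0 : Plane) 10, ρ x ^ p) ^ (1 / p) ≤ ENNReal.ofReal κ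

/-- Hölder in the chart, which preserves area and stays in the large disc. Only measurability of `f`
is needed. -/
theorem lintegral_slab_le {p κ : ℝ} (hp : 1 < p) {ρ : Plane → ℝ≥0∞} (hρ : Measurable ρ)
    (hκ : HasLocalLpBound p κ ρ) {ι : Plane ≃ᵢ Plane} (hι : IsNormalized ι) {f : ℝ → ℝ}
    (hfm : Measurable f) (hf : ∀ x, f x ∈ Set.Icc (0 : ℝ) 1) {S : Set (ℝ × ℝ)}
    (hS : S ⊆ Set.Icc (-1 : ℝ) 2 ×ˢ Set.Icc (-1 : ℝ) 2) :
    ∫⁻ z in S, ρ (slab ι f z) ≤ ENNReal.ofReal κ * volume S ^ (1 - 1 / p) := by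
  have hmp := measurePreserving_slab ι hfm
  refine (setLIntegral_le_rpow_mul (hρ.comp hmp.measurable) hp S).trans ?_
  gcongr
  refine le_trans ?_ hκ
  have hp0 : 0 ≤ 1 / p := by positivity
  refine ENNReal.rpow_le_rpow ?_ hp0
  calc ∫⁻ z in S, ρ (slab ι f z) ^ p
      ≤ ∫⁻ z in slab ι f ⁻¹' Metric.ball (0 : Plane) 10, ρ (slab ι f z) ^ p :=
        lintegral_mono_set fun z hz => slab_mem_ball hι hf (hS hz)
    _ = ∫⁻ x in Metric.ball (0 : Plane) 10, ρ x ^ p :=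
        hmp.setLIntegral_comp_preimage measurableSet_ball (hρ.pow_const p)

/-! ### A finite net of isometries and the cost of moving to it -/

theorem IsometryEquiv.apply_eq_affine (ι : Plane ≃ᵢ Plane) (z : Plane) :
    ι z = (1 - z 0 - z 1) • ι 0 + z 0 • ι !₂[1, 0] + z 1 • ι !₂[0, 1] := by
  have hz : z = z 0 • !₂[1, 0] + z 1 • !₂[0, 1] := by
    ext i
    fin_cases i <;> simp
  have h := ι.toRealLinearIsometryEquiv.map_add (z 0 • !₂[1, 0]) (z 1 • !₂[0, 1])
  rw [← hz, map_smul, map_smul] at h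
  simp only [IsometryEquiv.toRealLinearIsometryEquiv_apply] at h
  rw [sub_eq_iff_eq_add] at h
  rw [h]
  module

/-- The three points whose images determine a plane isometry. -/
noncomputable def framePoint (k : Fin 3) : Plane := ![0, !₂[1, 0], !₂[0, 1]] k

theorem IsNormalized.framePoint_mem {ι : Plane ≃ᵢ Plane} (hι : IsNormalized ι) (k : Fin 3)
    (i : Fin 2) : ι (framePoint k) i ∈ Set.Icc (-1 : ℝ) 2 := by
  have hn : ‖framePoint k‖ ≤ 1 := by
    fin_cases k <;> simp [framePoint, EuclideanSpace.norm_eq]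
  have hd : |ι (framePoint k) i - ι 0 i| ≤ 1 := by
    have := plane_abs_coord_le (ι (framePoint k) - ι 0) i
    rw [← dist_eq_norm, ι.dist_eq, dist_zero_right] at this
    simpa using this.trans hn
  have h0 := hι i
  have := abs_le.1 hd
  exact ⟨by linarith [h0.1], by linarith [h0.2]⟩

/-- Both isometries are affine in the frame, with weights at most 5, 2, 2; each frame point moves by
at most `2ε`, whence 18. -/
theorem dist_le_of_framePoint {ι ι' : Plane ≃ᵢ Plane} {ε : ℝ}
    (h : ∀ k i, |ι (framePoint k) i - ι' (framePoint k) i| ≤ ε) {z : Plane}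
    (h0 : |z 0| ≤ 2) (h1 : |z 1| ≤ 2) : dist (ι z) (ι' z) ≤ 18 * ε := by
  have hk : ∀ k, ‖ι (framePoint k) - ι' (framePoint k)‖ ≤ 2 * ε := fun k => by
    refine (plane_norm_le _).trans ?_
    have := h k 0
    have := h k 1
    simp only [PiLp.sub_apply]
    linarith
  have e0 := hk 0
  have e1 := hk 1
  have e2 := hk 2
  simp only [framePoint, Matrix.cons_val_zero, Matrix.cons_val_one, Matrix.cons_val] at e0 e1 e2
  have hε : 0 ≤ ε := by linarith [norm_nonneg (ι 0 - ι' 0)]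
  rw [dist_eq_norm, ι.apply_eq_affine z, ι'.apply_eq_affine z,
    show (1 - z 0 - z 1) • ι 0 + z 0 • ι !₂[1, 0] + z 1 • ι !₂[0, 1] -
      ((1 - z 0 - z 1) • ι' 0 + z 0 • ι' !₂[1, 0] + z 1 • ι' !₂[0, 1]) =
      (1 - z 0 - z 1) • (ι 0 - ι' 0) + z 0 • (ι !₂[1, 0] - ι' !₂[1, 0]) +
        z 1 • (ι !₂[0, 1] - ι' !₂[0, 1]) by module]
  refine (norm_add₃_le).trans ?_
  simp only [norm_smul, Real.norm_eq_abs]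
  have h2 : |1 - z 0 - z 1| ≤ 5 := by
    have := abs_le.1 h0
    have := abs_le.1 h1
    exact abs_le.2 ⟨by linarith, by linarith⟩
  calc _ ≤ 5 * (2 * ε) + 2 * (2 * ε) + 2 * (2 * ε) := by gcongr
    _ = 18 * ε := by ring

/-- A finite net in the set of normalised isometries, of polynomial size. -/
theorem exists_isometry_net {n : ℕ} (hn : 0 < n) :
    ∃ net : (Fin 3 × Fin 2 → Fin (3 * n + 1)) → (Plane ≃ᵢ Plane),
      (∀ k, IsNormalized (net k)) ∧ ∀ ι, IsNormalized ι → ∃ k, ∀ z : Plane, |z 0| ≤ 2 → |z 1| ≤ 2 →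
        dist (ι z) (net k z) ≤ 18 / n := by
  have hn' : (0 : ℝ) < n := by exact_mod_cast hn
  -- The six frame coordinates, shifted from `[-1,2]` to `[0,3]` and rounded down at resolution
  -- `1/n`; the net picks one isometry for each key that occurs.
  set key : (Plane ≃ᵢ Plane) → Fin 3 × Fin 2 → ℕ := fun ι q =>
    ⌊n * (ι (framePoint q.1) q.2 + 1)⌋₊ with hkey
  have hkeylt : ∀ ι, IsNormalized ι → ∀ q, key ι q < 3 * n + 1 := by
    intro ι hι q
    have h := hι.framePoint_mem q.1 q.2
    rw [hkey, Nat.floor_lt (mul_nonneg hn'.le (by linarith [h.1]))]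
    push_cast
    nlinarith [h.2]
  have hone : IsNormalized (IsometryEquiv.refl Plane) := fun i => by
    change (0 : ℝ) ∈ Set.Ico (0 : ℝ) 1
    simp
  classical
  set net : (Fin 3 × Fin 2 → Fin (3 * n + 1)) → (Plane ≃ᵢ Plane) := fun c =>
    if h : ∃ ι, IsNormalized ι ∧ ∀ q, key ι q = c q then h.choose else IsometryEquiv.refl Plane
    with hnet
  refine ⟨net, fun c => ?_, fun ι hι => ?_⟩
  · simp only [hnet]
    split_ifs with h
    · exact h.choose_spec.1
    · exact hone
  · have h : ∃ ι' : Plane ≃ᵢ Plane, IsNormalized ι' ∧ ∀ q, key ι' q = key ι q :=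
      ⟨ι, hι, fun _ => rfl⟩
    refine ⟨fun q => ⟨key ι q, hkeylt ι hι q⟩, fun z h0 h1 => ?_⟩
    have hspec : IsNormalized (net fun q => ⟨key ι q, hkeylt ι hι q⟩) ∧
        ∀ q, key (net fun q => ⟨key ι q, hkeylt ι hι q⟩) q = key ι q := by
      simp only [hnet]
      rw [dif_pos h]
      exact h.choose_spec
    set ι' := net fun q => ⟨key ι q, hkeylt ι hι q⟩
    rw [show (18 : ℝ) / n = 18 * (1 / n) by ring]
    refine dist_le_of_framePoint (fun k i => ?_) h0 h1
    have e1 := hι.framePoint_mem k i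
    have e2 := hspec.1.framePoint_mem k i
    have e3 := hspec.2 (k, i)
    simp only [hkey] at e3
    have f1 := Nat.floor_le (a := n * (ι (framePoint k) i + 1))
      (mul_nonneg hn'.le (by linarith [e1.1]))
    have f2 := Nat.floor_le (a := n * (ι' (framePoint k) i + 1))
      (mul_nonneg hn'.le (by linarith [e2.1]))
    have f3 := Nat.lt_floor_add_one (n * (ι (framePoint k) i + 1))
    have f4 := Nat.lt_floor_add_one (n * (ι' (framePoint k) i + 1))
    rw [e3] at f2 f4
    rw [abs_le]
    constructor
    · rw [neg_le, le_div_iff₀ hn']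
      nlinarith
    · rw [le_div_iff₀ hn']
      nlinarith

theorem setLIntegral_slab_eq {ρ : Plane → ℝ≥0∞} (hρ : Measurable ρ) (ι : Plane ≃ᵢ Plane)
    {f : ℝ → ℝ} (hf : Measurable f) {S : Set (ℝ × ℝ)} (hS : MeasurableSet S) :
    ∫⁻ z in S, ρ (slab ι f z) =
      ∫⁻ y in {y : Plane | (ι.symm y 0, ι.symm y 1 - f (ι.symm y 0)) ∈ S}, ρ y := by
  have hm : Measurable fun y : Plane => (ι.symm y 0, ι.symm y 1 - f (ι.symm y 0)) := by
    have h0 : ∀ i, Measurable fun y : Plane => ι.symm y i := fun i =>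
      (EuclideanSpace.proj (𝕜 := ℝ) i).continuous.measurable.comp ι.symm.continuous.measurable
    exact (h0 0).prodMk ((h0 1).sub (hf.comp (h0 0)))
  refine Eq.trans ?_ ((measurePreserving_slab ι hf).setLIntegral_comp_preimage (hm hS) hρ)
  congr 2
  ext z
  simp [slab]

/-- The domain in the slab chart that corresponds to the heights `[0,h]` above the graph. -/
def slabBox (h : ℝ) : Set (ℝ × ℝ) := Set.Ioc 0 1 ×ˢ Set.Icc 0 h

theorem measurableSet_slabBox (h : ℝ) : MeasurableSet (slabBox h) :=
  measurableSet_Ioc.prod measurableSet_Icc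

/-- A fixed point of the plane has coordinates under `ι` and `ι'` that differ by at most `δ`; since
`f` is 1-Lipschitz, its height above the graph changes by at most `2δ`. -/
theorem setLIntegral_slab_le_of_dist_le {ρ : Plane → ℝ≥0∞} (hρ : Measurable ρ)
    {ι ι' : Plane ≃ᵢ Plane} {f : ℝ → ℝ} (hf : LipschitzWith 1 f)
    (hf01 : ∀ x, f x ∈ Set.Icc (0 : ℝ) 1) {h δ : ℝ} (h1 : h ≤ 1)
    (hδ : ∀ z : Plane, |z 0| ≤ 2 → |z 1| ≤ 2 → dist (ι z) (ι' z) ≤ δ) :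
    ∫⁻ z in slabBox h, ρ (slab ι f z) ≤
      ∫⁻ z in Set.Icc (-(2 * δ)) (1 + 2 * δ) ×ˢ Set.Icc (-(2 * δ)) (h + 2 * δ),
        ρ (slab ι' f z) := by
  have hfm := hf.continuous.measurable
  rw [setLIntegral_slab_eq hρ ι hfm (measurableSet_slabBox h),
    setLIntegral_slab_eq hρ ι' hfm (measurableSet_Icc.prod measurableSet_Icc)]
  refine lintegral_mono_set fun y hy => ?_
  obtain ⟨⟨hx0, hx1⟩, hu0, hu1⟩ := hy
  simp only at hx0 hx1 hu0 hu1
  set z := ι.symm y with hz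
  set w := ι'.symm y with hw
  have hfz := hf01 (z 0)
  have hd : ‖w - z‖ ≤ δ := by
    have := hδ z (abs_le.2 ⟨by linarith, by linarith⟩)
      (abs_le.2 ⟨by linarith [hfz.1], by linarith [hfz.2]⟩)
    rw [hz, ι.apply_symm_apply, ← hz] at this
    rw [← dist_eq_norm, ← ι'.dist_eq, hw, ι'.apply_symm_apply]
    exact this
  have d0 := (plane_abs_coord_le (w - z) 0).trans hd
  have d1 := (plane_abs_coord_le (w - z) 1).trans hd
  simp only [PiLp.sub_apply] at d0 d1
  have df := hf.dist_le_mul (w 0) (z 0)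
  rw [NNReal.coe_one, one_mul, Real.dist_eq, Real.dist_eq] at df
  have d0' := abs_le.1 d0
  have d1' := abs_le.1 d1
  have df' := abs_le.1 (df.trans d0)
  exact ⟨⟨by linarith, by linarith⟩, by simp only; linarith, by simp only; linarith⟩

theorem setLIntegral_slab_le_add {p κ : ℝ} (hp : 1 < p) {ρ : Plane → ℝ≥0∞} (hρ : Measurable ρ)
    (hκ : HasLocalLpBound p κ ρ) {ι ι' : Plane ≃ᵢ Plane} (hι' : IsNormalized ι') {f : ℝ → ℝ}
    (hf : LipschitzWith 1 f) (hf01 : ∀ x, f x ∈ Set.Icc (0 : ℝ) 1) {h δ : ℝ} (h0 : 0 ≤ h)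
    (h1 : h ≤ 1) (hδ0 : 0 ≤ δ) (hδ1 : 4 * δ ≤ 1)
    (hδ : ∀ z : Plane, |z 0| ≤ 2 → |z 1| ≤ 2 → dist (ι z) (ι' z) ≤ δ) :
    ∫⁻ z in slabBox h, ρ (slab ι f z) ≤ (∫⁻ z in slabBox h, ρ (slab ι' f z)) +
      ENNReal.ofReal κ * ENNReal.ofReal (12 * δ) ^ (1 - 1 / p) := by
  refine (setLIntegral_slab_le_of_dist_le hρ hf hf01 h1 hδ).trans ?_
  set T := Set.Icc (-(2 * δ)) (1 + 2 * δ) ×ˢ Set.Icc (-(2 * δ)) (h + 2 * δ) with hT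
  have hsub : slabBox h ⊆ T := Set.prod_mono
    (fun x hx => ⟨by linarith [hx.1], by linarith [hx.2]⟩)
    (fun x hx => ⟨by linarith [hx.1], by linarith [hx.2]⟩)
  have hbig : T \ slabBox h ⊆ Set.Icc (-1 : ℝ) 2 ×ˢ Set.Icc (-1 : ℝ) 2 :=
    Set.sdiff_subset.trans (Set.prod_mono (Set.Icc_subset_Icc (by linarith) (by linarith))
      (Set.Icc_subset_Icc (by linarith) (by linarith)))
  have hvolS : volume (slabBox h) = ENNReal.ofReal h := by
    rw [slabBox, Measure.volume_eq_prod, Measure.prod_prod, Real.volume_Ioc, Real.volume_Icc]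
    simp
  -- The collar has area `(1 + 4δ)(h + 4δ) - h`, at most `12δ` because `h ≤ 1` and `4δ ≤ 1`.
  have hvol : volume (T \ slabBox h) ≤ ENNReal.ofReal (12 * δ) := by
    rw [measure_sdiff hsub (measurableSet_slabBox h).nullMeasurableSet (by simp [hvolS]), hvolS, hT,
      Measure.volume_eq_prod, Measure.prod_prod, Real.volume_Icc, Real.volume_Icc,
      ← ENNReal.ofReal_mul (by linarith), ← ENNReal.ofReal_sub _ h0]
    refine ENNReal.ofReal_le_ofReal ?_
    nlinarith
  calc ∫⁻ z in T, ρ (slab ι' f z)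
      ≤ (∫⁻ z in slabBox h, ρ (slab ι' f z)) + ∫⁻ z in T \ slabBox h, ρ (slab ι' f z) := by
        rw [← Set.union_sdiff_cancel hsub]
        refine (lintegral_union_le _ _ _).trans ?_
        rw [Set.union_sdiff_cancel hsub]
    _ ≤ _ := by
        gcongr
        refine (lintegral_slab_le hp hρ hκ hι' hf.continuous.measurable hf01 hbig).trans ?_
        gcongr
        rw [sub_nonneg, div_le_one (by linarith)]
        exact hp.le

/-! ### Cells, and one random perturbation -/

theorem sum_range_two_mul {R : Type*} [AddCommMonoid R] (m : ℕ) (F : ℕ → R) :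
    ∑ i ∈ Finset.range (2 * m), F i =
      ∑ k : Fin m, F (2 * k) + ∑ k : Fin m, F (2 * k + 1) := by
  rw [Fin.sum_univ_eq_sum_range (fun k => F (2 * k)) m,
    Fin.sum_univ_eq_sum_range (fun k => F (2 * k + 1)) m]
  induction m with
  | zero => simp
  | succ m ih =>
    rw [show 2 * (m + 1) = 2 * m + 1 + 1 by ring, Finset.sum_range_succ, Finset.sum_range_succ, ih,
      Finset.sum_range_succ, Finset.sum_range_succ]
    abel

/-- The `i`-th of the intervals of length `1 / n`. -/
def cell (n i : ℕ) : Set ℝ := Set.Ioc ((i : ℝ) / n) ((i + 1 : ℝ) / n)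

theorem setLIntegral_eq_sum_cell {n : ℕ} (hn : 0 < n) (F : ℝ → ℝ≥0∞) :
    ∫⁻ x in Set.Ioc (0 : ℝ) 1, F x = ∑ i ∈ Finset.range n, ∫⁻ x in cell n i, F x := by
  have hn' : (0 : ℝ) < n := by exact_mod_cast hn
  have key : ∀ k : ℕ, ∫⁻ x in Set.Ioc (0 : ℝ) (k / n), F x =
      ∑ i ∈ Finset.range k, ∫⁻ x in cell n i, F x := by
    intro k
    induction k with
    | zero => simp
    | succ k ih =>
      rw [Finset.sum_range_succ, ← ih, cell]
      push_cast
      rw [← lintegral_union measurableSet_Ioc (Set.Ioc_disjoint_Ioc_of_le le_rfl),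
        Set.Ioc_union_Ioc_eq_Ioc (by positivity) (by gcongr; linarith)]
  have := key n
  rwa [div_self hn'.ne'] at this

theorem cell_subset {n i : ℕ} (hi : i < n) : cell n i ⊆ Set.Icc (-1 : ℝ) 2 := by
  have hn' : (0 : ℝ) < n := by exact_mod_cast (Nat.zero_le i).trans_lt hi
  have hi' : (i : ℝ) + 1 ≤ n := by exact_mod_cast hi
  intro x hx
  have h1 : (0 : ℝ) ≤ i / n := by positivity
  have h2 : ((i : ℝ) + 1) / n ≤ 1 := (div_le_one hn').2 hi'
  exact ⟨by linarith [hx.1], by linarith [hx.2]⟩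

theorem volume_cell_prod {n : ℕ} (i : ℕ) (h : ℝ) :
    volume (cell n i ×ˢ Set.Icc 0 h) = ENNReal.ofReal (h / n) := by
  rw [cell, Measure.volume_eq_prod, Measure.prod_prod, Real.volume_Ioc, Real.volume_Icc,
    ← ENNReal.ofReal_mul (by rw [← sub_div]; simp)]
  congr 1
  ring

/-- The sequence `α 0, β 0, α 1, β 1, …`, with indices taken modulo `m`. -/
def interleave {m : ℕ} [NeZero m] {C : Type*} (α β : Fin m → C) (i : ℕ) : C :=
  if i % 2 = 0 then α (Fin.ofNat m (i / 2)) else β (Fin.ofNat m (i / 2))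

theorem interleave_even {m : ℕ} [NeZero m] {C : Type*} (α β : Fin m → C) (k : Fin m) :
    interleave α β (2 * k) = α k := by
  simp [interleave]

theorem interleave_odd {m : ℕ} [NeZero m] {C : Type*} (α β : Fin m → C) (k : Fin m) :
    interleave α β (2 * k + 1) = β k := by
  have h : (2 * (k : ℕ) + 1) / 2 = k := by omega
  simp [interleave, h, Nat.add_mod]

theorem interleave_succ_odd {m : ℕ} [NeZero m] {C : Type*} (α β : Fin m → C) (k : Fin m) :
    interleave α β (2 * k + 1 + 1) = α (Equiv.addRight 1 k) := by
  have h : (2 * (k : ℕ) + 1 + 1) / 2 = k + 1 := by omega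
  have h' : Fin.ofNat m ((k : ℕ) + 1) = k + 1 := by
    ext
    simp [Fin.val_add]
  have h2 : (2 * (k : ℕ) + 1 + 1) % 2 = 0 := by omega
  rw [interleave, if_pos h2, h, h', Equiv.coe_addRight]

/-- The mass of `ρ` over a cell, at heights `[0,h]` above the graph of `f` shifted up by the
random profile determined by the endpoints `q`. -/
noncomputable def cellMass (ρ : Plane → ℝ≥0∞) (ι : Plane ≃ᵢ Plane) (f : ℝ → ℝ) (a h : ℝ) (n i : ℕ)
    (q : UnitAddCircle × UnitAddCircle) : ℝ≥0∞ :=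
  ∫⁻ x in cell n i, ∫⁻ u in Set.Icc 0 h, ρ (ι !₂[x, f x + (2 * a * ‖arcPoint (n * x - i) q‖ + u)])

theorem measurable_plane_mk {X : Type*} [MeasurableSpace X] {u v : X → ℝ} (hu : Measurable u)
    (hv : Measurable v) : Measurable fun x => (!₂[u x, v x] : Plane) := by
  have h2 := (volume_preserving_finTwoArrow ℝ).symm.measurable
  have h3 := (PiLp.volume_preserving_toLp (Fin 2)).measurable
  exact h3.comp (h2.comp (hu.prodMk hv))

theorem measurable_cellMass_integrand {ρ : Plane → ℝ≥0∞} (hρ : Measurable ρ) (ι : Plane ≃ᵢ Plane)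
    {f : ℝ → ℝ} (hf : Measurable f) {a : ℝ} (n i : ℕ) : Measurable
    fun z : ((UnitAddCircle × UnitAddCircle) × ℝ) × ℝ =>
      ρ (ι !₂[z.1.2, f z.1.2 + (2 * a * ‖arcPoint (n * z.1.2 - i) z.1.1‖ + z.2)]) := by
  have h1 : Measurable fun z : ((UnitAddCircle × UnitAddCircle) × ℝ) × ℝ =>
      arcPoint (n * z.1.2 - i) z.1.1 :=
    measurable_arcPoint.comp (by fun_prop :
      Measurable fun z : ((UnitAddCircle × UnitAddCircle) × ℝ) × ℝ => (n * z.1.2 - i, z.1.1))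
  have hx : Measurable fun z : ((UnitAddCircle × UnitAddCircle) × ℝ) × ℝ => z.1.2 := by fun_prop
  exact hρ.comp (ι.continuous.measurable.comp (measurable_plane_mk hx
    ((hf.comp hx).add ((h1.norm.const_mul _).add measurable_snd))))

theorem measurable_cellMass {ρ : Plane → ℝ≥0∞} (hρ : Measurable ρ) (ι : Plane ≃ᵢ Plane)
    {f : ℝ → ℝ} (hf : Measurable f) {a h : ℝ} (n i : ℕ) :
    Measurable (cellMass ρ ι f a h n i) := by
  unfold cellMass
  exact ((measurable_cellMass_integrand hρ ι hf n i).lintegral_prod_right'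
    (ν := volume.restrict (Set.Icc 0 h))).lintegral_prod_right'

/-- By Fubini it suffices to fix `x`; there the random profile is the fold of a uniform point of the
circle. -/
theorem lintegral_cellMass_le {ρ : Plane → ℝ≥0∞} (hρ : Measurable ρ) (ι : Plane ≃ᵢ Plane)
    {f : ℝ → ℝ} (hf : Measurable f) {a h : ℝ} (n i : ℕ)
    (ha : 0 < a) (hh : 0 ≤ h) :
    ∫⁻ q, cellMass ρ ι f a h n i q ∂(volume.prod volume) ≤ ENNReal.ofReal (h / a) *
      ∫⁻ x in cell n i, ∫⁻ w in Set.Icc 0 (a + h), ρ (ι !₂[x, f x + w]) := by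
  have hm := (measurable_cellMass_integrand hρ ι hf (a := a) n i).lintegral_prod_right'
    (ν := volume.restrict (Set.Icc 0 h))
  unfold cellMass
  rw [lintegral_lintegral_swap hm.aemeasurable]
  have hφ : Measurable fun z : ℝ × ℝ => ρ (ι !₂[z.1, f z.1 + z.2]) :=
    hρ.comp (measurePreserving_slab ι hf).measurable
  rw [← lintegral_const_mul _ (hφ.lintegral_prod_right' (ν := volume.restrict (Set.Icc 0 (a + h))))]
  refine lintegral_mono fun x => ?_
  have hφx : Measurable fun w => ρ (ι !₂[x, f x + w]) := hφ.comp measurable_prodMk_left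
  have hFm : Measurable fun θ : UnitAddCircle =>
      ∫⁻ u in Set.Icc 0 h, ρ (ι !₂[x, f x + (2 * a * ‖θ‖ + u)]) := by
    have : Measurable fun z : UnitAddCircle × ℝ =>
        ρ (ι !₂[x, f x + (2 * a * ‖z.1‖ + z.2)]) :=
      hφx.comp (by fun_prop : Measurable fun z : UnitAddCircle × ℝ => 2 * a * ‖z.1‖ + z.2)
    exact this.lintegral_prod_right'
  exact (lintegral_arcPoint (n * x - i) hFm).trans_le (lintegral_circle_norm_le hφx ha hh)

theorem lintegral_slabBox_eq {ρ : Plane → ℝ≥0∞} (hρ : Measurable ρ) (ι : Plane ≃ᵢ Plane)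
    {f : ℝ → ℝ} (hf : Measurable f) (h : ℝ) :
    ∫⁻ z in slabBox h, ρ (slab ι f z) =
      ∫⁻ x in Set.Ioc 0 1, ∫⁻ u in Set.Icc 0 h, ρ (ι !₂[x, f x + u]) := by
  have hφ : Measurable fun z : ℝ × ℝ => ρ (slab ι f z) :=
    hρ.comp (measurePreserving_slab ι hf).measurable
  rw [slabBox, Measure.volume_eq_prod, setLIntegral_prod _ hφ.aemeasurable]
  rfl

/-- The deterministic bound required by Chernoff: for each outcome `q`, Hölder on a set of area
`h/n`. -/
theorem cellMass_le {p κ : ℝ} (hp : 1 < p) (hκ0 : 0 < κ) {ρ : Plane → ℝ≥0∞} (hρ : Measurable ρ)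
    (hκ : HasLocalLpBound p κ ρ) {ι : Plane ≃ᵢ Plane} (hι : IsNormalized ι) {f : ℝ → ℝ}
    (hfm : Measurable f) {a h : ℝ} (ha : 0 ≤ a) (hf : ∀ x, f x ∈ Set.Icc (0 : ℝ) (1 - a))
    (hh : 0 < h) (hh1 : h ≤ 1) {n i : ℕ} (hi : i < n) (q : UnitAddCircle × UnitAddCircle) :
    cellMass ρ ι f a h n i q ≤ ENNReal.ofReal (κ * (h / n) ^ (1 - 1 / p)) := by
  set F : ℝ → ℝ := fun x => f x + 2 * a * ‖arcPoint (n * x - i) q‖ with hF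
  have hFm : Measurable F := by
    have h1 : Measurable fun x : ℝ => arcPoint (n * x - i) q :=
      measurable_arcPoint.comp (by fun_prop : Measurable fun x : ℝ => ((n * x - i : ℝ), q))
    exact hfm.add (h1.norm.const_mul _)
  have hF01 : ∀ x, F x ∈ Set.Icc (0 : ℝ) 1 := fun x => by
    have h1 : ‖arcPoint (n * x - i) q‖ ≤ 1 / 2 := by
      simpa using AddCircle.norm_le_half_period (1 : ℝ) (x := arcPoint (n * x - i) q) one_ne_zero
    have h2 := hf x
    exact ⟨add_nonneg h2.1 (by positivity), by simp only [hF]; nlinarith [h2.2]⟩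
  have hn' : (0 : ℝ) < n := by exact_mod_cast (Nat.zero_le i).trans_lt hi
  have hS : cell n i ×ˢ Set.Icc 0 h ⊆ Set.Icc (-1 : ℝ) 2 ×ˢ Set.Icc (-1 : ℝ) 2 :=
    Set.prod_mono (cell_subset hi) (Set.Icc_subset_Icc (by norm_num) (by linarith))
  have hle := lintegral_slab_le hp hρ hκ hι hFm hF01 hS
  rw [volume_cell_prod, ENNReal.ofReal_rpow_of_pos (by positivity),
    ← ENNReal.ofReal_mul hκ0.le] at hle
  refine le_trans (le_of_eq ?_) hle
  have hφ : Measurable fun z : ℝ × ℝ => ρ (slab ι F z) :=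
    hρ.comp (measurePreserving_slab ι hFm).measurable
  rw [Measure.volume_eq_prod, setLIntegral_prod _ hφ.aemeasurable, cellMass]
  simp only [slab, hF, add_assoc]

/-- Given finitely many congruent copies of a graph, the graph can be perturbed so that
in the neighbourhood of each copy at the smaller scale `h` the mass of `ρ` is
controlled by its mass at the larger scale `a + h`. -/
theorem exists_perturbation {p κ : ℝ} (hp : 1 < p) (hκ0 : 0 < κ) {ρ : Plane → ℝ≥0∞}
    (hρ : Measurable ρ) (hκ : HasLocalLpBound p κ ρ) {J : Type*} [Fintype J] [Nonempty J]
    {net : J → (Plane ≃ᵢ Plane)} (hnet : ∀ j, IsNormalized (net j)) {f : ℝ → ℝ}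
    (hfm : Measurable f) {a h η : ℝ} (ha : 0 < a) (hf : ∀ x, f x ∈ Set.Icc (0 : ℝ) (1 - a))
    (hh : 0 < h) (hh1 : h ≤ 1) (hη : 0 < η) (hη1 : η ≤ 1) {m : ℕ} (hm : 0 < m) :
    ∃ g : ℝ → ℝ, (∀ x y, |g x - g y| ≤ 4 * a * m * |x - y|) ∧ (∀ x, g x ∈ Set.Icc 0 a) ∧
      ∀ j, ∫⁻ z in slabBox h, ρ (slab (net j) (fun x => f x + g x) z) ≤
        ENNReal.ofReal (1 + η) *
          (ENNReal.ofReal (h / a) * ∫⁻ z in slabBox (a + h), ρ (slab (net j) f z)) +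
        ENNReal.ofReal (2 * (κ * (h / (2 * m : ℕ)) ^ (1 - 1 / p) / η *
          Real.log (2 * Fintype.card J))) := by
  have hm' : (0 : ℝ) < m := by exact_mod_cast hm
  have : NeZero m := ⟨hm.ne'⟩
  have hlt0 : ∀ k : Fin m, 2 * (k : ℕ) < 2 * m := fun k => by omega
  have hlt1 : ∀ k : Fin m, 2 * (k : ℕ) + 1 < 2 * m := fun k => by omega
  have hM : 0 < κ * (h / (2 * m : ℕ)) ^ (1 - 1 / p) := by
    push_cast
    positivity
  have : IsProbabilityMeasure (volume : Measure UnitAddCircle) := ⟨by simp⟩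
  -- Even cells see `(α k, β k)`, odd cells `(β k, α (k+1))`. Closing up cyclically makes the shift
  -- a permutation.
  obtain ⟨α, β, hαβ⟩ := exists_forall_sum_le (volume : Measure UnitAddCircle)
    (Equiv.addRight (1 : Fin m))
    (Y := fun j k => cellMass ρ (net j) f a h (2 * m) (2 * k))
    (Z := fun j k => cellMass ρ (net j) f a h (2 * m) (2 * k + 1))
    (fun j k => measurable_cellMass hρ _ hfm _ _) (fun j k => measurable_cellMass hρ _ hfm _ _)
    hM hη hη1
    (fun j k => cellMass_le hp hκ0 hρ hκ (hnet j) hfm ha.le hf hh hh1 (hlt0 k))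
    (fun j k => cellMass_le hp hκ0 hρ hκ (hnet j) hfm ha.le hf hh hh1 (hlt1 k))
  set ν := interleave α β with hν
  -- The norm is at most `1/2`, so `g ≤ a`; amplitude `2a` and speed `2m` give slope `4am`.
  set g : ℝ → ℝ := fun x => 2 * a * ‖circlePath (2 * m) ν ((2 * m : ℕ) * x)‖ with hg
  have hglip : ∀ x y, |g x - g y| ≤ 4 * a * m * |x - y| := fun x y => by
    have h1 := (lipschitzWith_circlePath (2 * m) ν).dist_le_mul ((2 * m : ℕ) * x) ((2 * m : ℕ) * y)
    have h2 := abs_norm_sub_norm_le (circlePath (2 * m) ν ((2 * m : ℕ) * x))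
      (circlePath (2 * m) ν ((2 * m : ℕ) * y))
    rw [← dist_eq_norm] at h2
    have h3 := h2.trans h1
    rw [NNReal.coe_one, one_mul, Real.dist_eq, ← mul_sub, abs_mul, Nat.abs_cast] at h3
    simp only [hg]
    rw [← mul_sub, abs_mul, abs_of_pos (by positivity : (0 : ℝ) < 2 * a)]
    push_cast at h3 ⊢
    calc _ ≤ 2 * a * (2 * m * |x - y|) := by gcongr
      _ = _ := by ring
  have hgcont : Measurable g := by
    have := (lipschitzWith_circlePath (2 * m) ν).continuous
    exact Continuous.measurable (by fun_prop)
  refine ⟨g, hglip, fun x => ⟨by positivity, ?_⟩, fun j => ?_⟩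
  · have h1 : ‖circlePath (2 * m) ν ((2 * m : ℕ) * x)‖ ≤ 1 / 2 := by
      simpa using AddCircle.norm_le_half_period (1 : ℝ)
        (x := circlePath (2 * m) ν ((2 * m : ℕ) * x)) one_ne_zero
    simp only [hg]
    nlinarith
  have hcell : ∀ i < 2 * m, ∫⁻ x in cell (2 * m) i, ∫⁻ u in Set.Icc 0 h,
      ρ (net j !₂[x, f x + g x + u]) = cellMass ρ (net j) f a h (2 * m) i (ν i, ν (i + 1)) := by
    intro i hi
    refine setLIntegral_congr_fun measurableSet_Ioc fun x hx => ?_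
    have hmem : ((2 * m : ℕ) : ℝ) * x ∈ Set.Icc (i : ℝ) (i + 1) := by
      have h2m : (0 : ℝ) < (2 * m : ℕ) := by exact_mod_cast (Nat.zero_le i).trans_lt hi
      exact ⟨by have := hx.1.le; rwa [div_le_iff₀' h2m] at this,
        by have := hx.2; rwa [le_div_iff₀' h2m] at this⟩
    simp only [hg]
    rw [circlePath_eq_arcPoint ν hi hmem]
    simp only [add_assoc]
  have hsum : ∫⁻ z in slabBox h, ρ (slab (net j) (fun x => f x + g x) z) =
      ∑ k : Fin m, cellMass ρ (net j) f a h (2 * m) (2 * k) (α k, β k) +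
        ∑ k : Fin m, cellMass ρ (net j) f a h (2 * m) (2 * k + 1)
          (β k, α (Equiv.addRight (1 : Fin m) k)) := by
    rw [lintegral_slabBox_eq hρ _ (f := fun x => f x + g x) (hfm.add hgcont),
      setLIntegral_eq_sum_cell (n := 2 * m) (by omega),
      Finset.sum_congr rfl fun i hi => hcell i (Finset.mem_range.1 hi), sum_range_two_mul]
    congr 1
    · refine Finset.sum_congr rfl fun k _ => ?_
      rw [hν, interleave_even, interleave_odd]
    · refine Finset.sum_congr rfl fun k _ => ?_
      rw [hν, interleave_odd, interleave_succ_odd]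
  rw [hsum]
  refine (hαβ j).trans ?_
  gcongr
  rw [lintegral_slabBox_eq hρ _ hfm, setLIntegral_eq_sum_cell (n := 2 * m) (by omega),
    sum_range_two_mul, mul_add, Finset.mul_sum, Finset.mul_sum]
  gcongr
  · exact lintegral_cellMass_le hρ _ hfm _ _ ha hh.le
  · exact lintegral_cellMass_le hρ _ hfm _ _ ha hh.le

/-- The mean mass of `ρ` at heights `[0,h]` above any normalised copy of the graph of `f` is at
most `B`. -/
def HasSlabBound (ρ : Plane → ℝ≥0∞) (f : ℝ → ℝ) (h B : ℝ) : Prop :=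
  ∀ ι, IsNormalized ι → ∫⁻ z in slabBox h, ρ (slab ι f z) ≤ ENNReal.ofReal (h * B)

/-- Passes from the net to all normalised isometries. The two error terms come from Chernoff and
from the collar of width `O(1/N)`; `72 ≤ N` is `4 · 18/N ≤ 1`. -/
theorem exists_perturbation_hasSlabBound {p κ : ℝ} (hp : 1 < p) (hκ0 : 0 < κ) {ρ : Plane → ℝ≥0∞}
    (hρ : Measurable ρ) (hκ : HasLocalLpBound p κ ρ) {f : ℝ → ℝ} {L a h η B : ℝ}
    (hL : ∀ x y, |f x - f y| ≤ L * |x - y|) (ha : 0 < a)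
    (hf : ∀ x, f x ∈ Set.Icc (0 : ℝ) (1 - a)) (hh : 0 < h) (hh1 : h ≤ 1) (hη : 0 < η)
    (hη1 : η ≤ 1) {m : ℕ} (hm : 0 < m) (hLm : L + 4 * a * m ≤ 1) {N : ℕ} (hN : 72 ≤ N)
    (hB : 0 ≤ B) (hfB : HasSlabBound ρ f (a + h) B) :
    ∃ f' : ℝ → ℝ, (∀ x y, |f' x - f' y| ≤ (L + 4 * a * m) * |x - y|) ∧
      (∀ x, f' x ∈ Set.Icc (f x) (f x + a)) ∧
      HasSlabBound ρ f' h ((1 + η) * ((a + h) / a) * B +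
        κ * (2 * (h / (2 * m : ℕ)) ^ (1 - 1 / p) / (h * η) *
          Real.log (2 * ((3 * N + 1 : ℕ) : ℝ) ^ 6) + (216 / N) ^ (1 - 1 / p) / h)) := by
  have hN0 : (0 : ℝ) < N := by exact_mod_cast (by omega : 0 < N)
  have hN72 : (72 : ℝ) ≤ N := by exact_mod_cast hN
  have hm' : (0 : ℝ) < m := by exact_mod_cast hm
  obtain ⟨net, hnet, hcover⟩ := exists_isometry_net (n := N) (by omega)
  have hfcont : Continuous f := by
    have : LipschitzWith (Real.toNNReal L) f := LipschitzWith.of_dist_le_mul fun x y => by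
      rw [Real.dist_eq, Real.dist_eq]
      exact (hL x y).trans (mul_le_mul_of_nonneg_right (Real.le_coe_toNNReal L) (abs_nonneg _))
    exact this.continuous
  obtain ⟨g, hglip, hg, hgj⟩ := exists_perturbation hp hκ0 hρ hκ hnet hfcont.measurable ha hf hh hh1
    hη hη1 hm
  set f' : ℝ → ℝ := fun x => f x + g x with hf'
  have hlip : ∀ x y, |f' x - f' y| ≤ (L + 4 * a * m) * |x - y| := fun x y => by
    have h1 : f' x - f' y = (f x - f y) + (g x - g y) := by simp only [hf']; ring
    rw [h1, add_mul]
    exact (abs_add_le _ _).trans (add_le_add (hL x y) (hglip x y))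
  have hf'lip : LipschitzWith 1 f' := LipschitzWith.of_dist_le_mul fun x y => by
    rw [Real.dist_eq, Real.dist_eq, NNReal.coe_one]
    exact (hlip x y).trans (mul_le_mul_of_nonneg_right hLm (abs_nonneg _))
  have hf'01 : ∀ x, f' x ∈ Set.Icc (0 : ℝ) 1 := fun x =>
    ⟨add_nonneg (hf x).1 (hg x).1, by simp only [hf']; linarith [(hf x).2, (hg x).2]⟩
  refine ⟨f', hlip, fun x => ⟨by simp only [hf']; linarith [(hg x).1],
    by simp only [hf']; linarith [(hg x).2]⟩, fun ι hι => ?_⟩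
  obtain ⟨j, hj⟩ := hcover ι hι
  have hδ : 4 * (18 / (N : ℝ)) ≤ 1 := by
    rw [← mul_div_assoc, div_le_one hN0]
    linarith
  have h1 := setLIntegral_slab_le_add hp hρ hκ (hnet j) hf'lip hf'01 hh.le hh1 (by positivity)
    hδ hj
  have hcard : (Fintype.card (Fin 3 × Fin 2 → Fin (3 * N + 1)) : ℝ) =
      ((3 * N + 1 : ℕ) : ℝ) ^ 6 := by
    simp
  have hlog : 0 ≤ Real.log (2 * ((3 * N + 1 : ℕ) : ℝ) ^ 6) := by
    refine Real.log_nonneg ?_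
    have : (1 : ℝ) ≤ ((3 * N + 1 : ℕ) : ℝ) ^ 6 := one_le_pow₀ (by push_cast; linarith)
    linarith
  have h2 := hgj j
  rw [hcard] at h2
  have h3 : ENNReal.ofReal (1 + η) *
      (ENNReal.ofReal (h / a) * ∫⁻ z in slabBox (a + h), ρ (slab (net j) f z)) ≤
      ENNReal.ofReal ((1 + η) * (h / a * ((a + h) * B))) := by
    rw [ENNReal.ofReal_mul (by positivity), ENNReal.ofReal_mul (by positivity)]
    gcongr
    exact hfB _ (hnet j)
  refine (h1.trans (add_le_add (h2.trans (add_le_add h3 le_rfl)) le_rfl)).trans_eq ?_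
  rw [show 12 * (18 / (N : ℝ)) = 216 / N by ring, ENNReal.ofReal_rpow_of_pos (by positivity),
    ← ENNReal.ofReal_mul hκ0.le, ← ENNReal.ofReal_add (by positivity) (by positivity),
    ← ENNReal.ofReal_add (by positivity) (by positivity)]
  congr 1
  field_simp
  ring

/-! ### Choice of scales and summability of the errors -/

/-- The reciprocal of the scale at stage `j`. -/
def invScale (N j : ℕ) : ℕ := 2 ^ (N * 2 ^ j)

theorem invScale_succ (N j : ℕ) : invScale N (j + 1) = invScale N j ^ 2 := by
  rw [invScale, invScale, ← pow_mul, pow_succ, mul_assoc]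

/-- Half the number of cells into which the unit interval is divided at stage `j`. -/
def cellCount (N j : ℕ) : ℕ := 2 ^ (N * 2 ^ j - (j + 3))

theorem le_mul_two_pow {N : ℕ} (hN : 5 ≤ N) (j : ℕ) : j + 5 ≤ N * 2 ^ j := by
  have h : j + 1 ≤ 2 ^ j := Nat.lt_two_pow_self
  nlinarith

theorem cellCount_mul {N : ℕ} (hN : 5 ≤ N) (j : ℕ) :
    (cellCount N j : ℝ) * 2 ^ (j + 3) = invScale N j := by
  have h := le_mul_two_pow hN j
  rw [cellCount, invScale]
  push_cast
  rw [← pow_add]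
  congr 1
  omega

theorem two_pow_le_invScale {N : ℕ} (hN : 5 ≤ N) (j : ℕ) : (2 : ℝ) ^ (j + 5) ≤ invScale N j := by
  rw [invScale]
  push_cast
  exact pow_le_pow_right₀ (by norm_num) (le_mul_two_pow hN j)

/-- The right side is `2^(αN·2^j)` with `2^j ≥ j + 1`: one factor `2^(αN)` absorbs `3904 N`, and `αN
≥ 4` makes the others absorb `2^(4j)`. Here `3904 = 61 · 64`, with 61 from `log_net_card_le`. -/
theorem exists_scale {α : ℝ} (hα : 0 < α) :
    ∃ N : ℕ, 5 ≤ N ∧ ∀ j : ℕ, (3904 * N * 2 ^ (4 * j) : ℝ) ≤ (invScale N j : ℝ) ^ α := by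
  have hr : 1 < (2 : ℝ) ^ α := Real.one_lt_rpow (by norm_num) hα
  have hlo := isLittleO_pow_const_const_pow_of_one_lt (R := ℝ) 1 hr
  have h1 := (Asymptotics.isLittleO_iff.1 hlo) (by norm_num : (0 : ℝ) < 1 / 3904)
  obtain ⟨N, hN1, hN5, hN4⟩ := (h1.and ((Filter.eventually_ge_atTop 5).and
    (Filter.eventually_ge_atTop ⌈4 / α⌉₊))).exists
  refine ⟨N, hN5, fun j => ?_⟩
  have hαN : 4 ≤ α * N := by
    have := Nat.ceil_le.1 hN4
    rwa [div_le_iff₀' hα] at this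
  have hN1' : (3904 * N : ℝ) ≤ 2 ^ (α * N) := by
    rw [Real.rpow_mul (by norm_num), Real.rpow_natCast]
    simp only [pow_one, Real.norm_eq_abs, Nat.abs_cast] at hN1
    rw [abs_of_pos (by positivity)] at hN1
    linarith
  have hj : ((j : ℝ) + 1) ≤ 2 ^ j := by exact_mod_cast (Nat.lt_two_pow_self : j < 2 ^ j)
  calc (3904 * N * 2 ^ (4 * j) : ℝ) ≤ 2 ^ (α * N) * (2 : ℝ) ^ (α * N * j) := by
        gcongr
        rw [← Real.rpow_natCast]
        push_cast
        gcongr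
        norm_num
    _ = 2 ^ (α * N * (j + 1)) := by
        rw [← Real.rpow_add (by norm_num)]
        ring_nf
    _ ≤ 2 ^ (α * N * 2 ^ j) := by
        gcongr
        norm_num
    _ = _ := by
        rw [invScale]
        push_cast
        rw [← Real.rpow_natCast 2 (N * 2 ^ j), ← Real.rpow_mul (by norm_num)]
        push_cast
        ring_nf

theorem log_net_card_le {n : ℕ} (hn : 32 ≤ n) :
    Real.log (2 * ((3 * (216 * n ^ 8) + 1 : ℕ) : ℝ) ^ 6) ≤ 61 * Real.log n := by
  have hn' : (32 : ℝ) ≤ n := by exact_mod_cast hn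
  rw [show (61 : ℝ) * Real.log n = Real.log ((n : ℝ) ^ 61) by rw [Real.log_pow]; norm_num]
  refine Real.log_le_log (by positivity) ?_
  have h1 : (((3 * (216 * n ^ 8) + 1 : ℕ) : ℝ)) ≤ (n : ℝ) ^ 10 := by
    push_cast
    have h8 : (1 : ℝ) ≤ (n : ℝ) ^ 8 := one_le_pow₀ (by linarith)
    have h2 : (32 : ℝ) ^ 2 ≤ (n : ℝ) ^ 2 := by gcongr
    have h10 : (n : ℝ) ^ 10 = (n : ℝ) ^ 8 * (n : ℝ) ^ 2 := by ring
    rw [h10]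
    nlinarith
  calc (2 : ℝ) * ((3 * (216 * n ^ 8) + 1 : ℕ) : ℝ) ^ 6 ≤ n * ((n : ℝ) ^ 10) ^ 6 := by
        gcongr
        linarith
    _ = (n : ℝ) ^ 61 := by ring

theorem log_invScale_le (N j : ℕ) : Real.log (invScale N j) ≤ N * 2 ^ j := by
  rw [invScale]
  push_cast
  rw [Real.log_pow]
  push_cast
  have : Real.log 2 ≤ 1 := by linarith [Real.log_two_lt_d9]
  exact mul_le_of_le_one_right (by positivity) this

/-- Since `2m = n/2^(j+2)`, a cell has area `2^(j+2) n⁻³`, and the Chernoff term is of order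
`n^(-(1-3/p)) log n` up to powers of `2^j`. The net at resolution `216 n^8` leaves a collar of area
at most `n⁻⁸`, costing at most `n⁻⁴` by Hölder, still small after division by `n⁻²`. -/
theorem error_le {p : ℝ} (hp : 3 < p) {N : ℕ} (hN : 5 ≤ N)
    (hscale : ∀ j : ℕ, (3904 * N * 2 ^ (4 * j) : ℝ) ≤ (invScale N j : ℝ) ^ (1 - 3 / p)) (j : ℕ) :
    2 * (1 / (invScale N j : ℝ) ^ 2 / (2 * cellCount N j : ℕ)) ^ (1 - 1 / p) /
        (1 / (invScale N j : ℝ) ^ 2 * (1 / 2 ^ (j + 2))) *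
        Real.log (2 * ((3 * (216 * invScale N j ^ 8) + 1 : ℕ) : ℝ) ^ 6) +
      (216 / (216 * invScale N j ^ 8 : ℕ)) ^ (1 - 1 / p) / (1 / (invScale N j : ℝ) ^ 2) ≤
      1 / 2 ^ j := by
  have hs := hscale j
  have hlog := log_invScale_le N j
  have hbig := two_pow_le_invScale hN j
  have hcm := cellCount_mul hN j
  set n := invScale N j with hn
  set m := cellCount N j with hm
  have h32 : (32 : ℝ) ≤ n := by
    refine le_trans ?_ hbig
    rw [pow_add]
    have : (1 : ℝ) ≤ 2 ^ j := one_le_pow₀ (by norm_num)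
    linarith
  have hn0 : (0 : ℝ) < n := by linarith
  have hcard := log_net_card_le (n := n) (by exact_mod_cast h32)
  have hp0 : 0 < p := by linarith
  have hθ1 : 1 - 1 / p ≤ 1 := by
    have : 0 < 1 / p := by positivity
    linarith
  have h3p : 1 / p < 1 / 3 := one_div_lt_one_div_of_lt (by norm_num) hp
  have hfirst : (1 / (n : ℝ) ^ 2 / (2 * m : ℕ)) ^ (1 - 1 / p) * (n : ℝ) ^ 2 ≤
      2 ^ (j + 2) * ((n : ℝ) ^ (1 - 3 / p))⁻¹ := by
    have e1 : 1 / (n : ℝ) ^ 2 / (2 * m : ℕ) = 2 ^ (j + 2) * ((n : ℝ) ^ (3 : ℝ))⁻¹ := by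
      rw [show (3 : ℝ) = ((3 : ℕ) : ℝ) by norm_num, Real.rpow_natCast]
      have hm0 : (m : ℝ) ≠ 0 := by
        intro h0
        rw [h0, zero_mul] at hcm
        linarith
      push_cast
      field_simp
      rw [← hcm]
      ring
    have e2 : ((2 : ℝ) ^ (j + 2)) ^ (1 - 1 / p) ≤ 2 ^ (j + 2) := by
      conv_rhs => rw [← Real.rpow_one ((2 : ℝ) ^ (j + 2))]
      exact Real.rpow_le_rpow_of_exponent_le (one_le_pow₀ (by norm_num)) hθ1
    rw [e1, Real.mul_rpow (by positivity) (by positivity), mul_assoc]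
    have e3 : (((n : ℝ) ^ (3 : ℝ))⁻¹) ^ (1 - 1 / p) * (n : ℝ) ^ 2 = ((n : ℝ) ^ (1 - 3 / p))⁻¹ := by
      rw [← Real.rpow_neg hn0.le, ← Real.rpow_neg hn0.le, ← Real.rpow_mul hn0.le,
        ← Real.rpow_natCast, ← Real.rpow_add hn0]
      congr 1
      push_cast
      field_simp
      ring
    rw [e3]
    gcongr
  have hterm1 : 2 * (1 / (n : ℝ) ^ 2 / (2 * m : ℕ)) ^ (1 - 1 / p) /
        (1 / (n : ℝ) ^ 2 * (1 / 2 ^ (j + 2))) *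
        Real.log (2 * ((3 * (216 * n ^ 8) + 1 : ℕ) : ℝ) ^ 6) ≤ 1 / 2 ^ j / 2 := by
    have e1 : 2 * (1 / (n : ℝ) ^ 2 / (2 * m : ℕ)) ^ (1 - 1 / p) /
        (1 / (n : ℝ) ^ 2 * (1 / 2 ^ (j + 2))) = 2 ^ (j + 3) *
          ((1 / (n : ℝ) ^ 2 / (2 * m : ℕ)) ^ (1 - 1 / p) * (n : ℝ) ^ 2) := by
      field_simp
      ring
    have hN0 : (0 : ℝ) < N := by exact_mod_cast (by omega : 0 < N)
    rw [e1]
    calc _ ≤ 2 ^ (j + 3) * (2 ^ (j + 2) * ((n : ℝ) ^ (1 - 3 / p))⁻¹) * (61 * (N * 2 ^ j)) := by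
          refine mul_le_mul (by gcongr) (hcard.trans (by gcongr)) ?_ (by positivity)
          refine Real.log_nonneg ?_
          have : (1 : ℝ) ≤ ((3 * (216 * n ^ 8) + 1 : ℕ) : ℝ) ^ 6 :=
            one_le_pow₀ (by exact_mod_cast Nat.le_add_left 1 _)
          linarith
      _ ≤ 2 ^ (j + 3) * (2 ^ (j + 2) * (3904 * N * 2 ^ (4 * j) : ℝ)⁻¹) * (61 * (N * 2 ^ j)) := by
          gcongr
      _ = 1 / 2 ^ j / 2 := by
          rw [show 4 * j = j + j + j + j by ring]
          simp only [pow_add]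
          field_simp
          norm_num
  have hterm2 : (216 / (216 * n ^ 8 : ℕ) : ℝ) ^ (1 - 1 / p) / (1 / (n : ℝ) ^ 2) ≤
      1 / 2 ^ j / 2 := by
    have e1 : (216 / (216 * n ^ 8 : ℕ) : ℝ) = 1 / (n : ℝ) ^ 8 := by
      push_cast
      field_simp
    have hle1 : 1 / (n : ℝ) ^ 8 ≤ 1 := by
      rw [div_le_one (by positivity)]
      exact one_le_pow₀ (by linarith)
    have e2 : (1 / (n : ℝ) ^ 8) ^ (1 - 1 / p) ≤ (1 / (n : ℝ) ^ 8) ^ (1 / 2 : ℝ) :=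
      Real.rpow_le_rpow_of_exponent_ge (by positivity) hle1 (by linarith)
    have e3 : (1 / (n : ℝ) ^ 8) ^ (1 / 2 : ℝ) = 1 / (n : ℝ) ^ 4 := by
      rw [← Real.sqrt_eq_rpow, show 1 / (n : ℝ) ^ 8 = (1 / (n : ℝ) ^ 4) ^ 2 by
        rw [div_pow, one_pow, ← pow_mul], Real.sqrt_sq (by positivity)]
    rw [e1, div_div_eq_mul_div, div_one]
    calc _ ≤ 1 / (n : ℝ) ^ 4 * (n : ℝ) ^ 2 := by
          gcongr
          exact e2.trans_eq e3
      _ = 1 / n / n := by field_simp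
      _ ≤ 1 / 2 ^ j / 2 := by
          gcongr
          · refine le_trans ?_ hbig
            exact pow_le_pow_right₀ (by norm_num) (by omega)
          · linarith
  calc _ ≤ 1 / (2 : ℝ) ^ j / 2 + 1 / 2 ^ j / 2 := add_le_add hterm1 hterm2
    _ = _ := by ring

/-! ### The inductive construction of the graphs -/

/-- A graph that is admissible at stage `j` of the construction. -/
structure IsStage (ρ : Plane → ℝ≥0∞) (κ : ℝ) (N j : ℕ) (f : ℝ → ℝ) : Prop where
  lipschitz : ∀ x y, |f x - f y| ≤ (1 - 1 / 2 ^ j) * |x - y|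
  mem : ∀ x, f x ∈ Set.Icc (0 : ℝ) (1 - 1 / invScale N j)
  bound : HasSlabBound ρ f (1 / invScale N j)
    (κ * ((invScale N 0 + 1) * Real.exp (2 - 2 / 2 ^ j) - 1))

theorem isStage_zero {p κ : ℝ} (hp : 1 < p) (hκ0 : 0 < κ) {ρ : Plane → ℝ≥0∞} (hρ : Measurable ρ)
    (hκ : HasLocalLpBound p κ ρ) {N : ℕ} : IsStage ρ κ N 0 0 := by
  have h1 : (1 : ℝ) ≤ invScale N 0 := by exact_mod_cast Nat.one_le_two_pow
  have h2 : 1 / (invScale N 0 : ℝ) ≤ 1 := (div_le_one (by linarith)).2 h1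
  refine ⟨by simp, fun x => ⟨le_rfl, by simpa using h2⟩, fun ι hι => ?_⟩
  have hS : slabBox (1 / invScale N 0 : ℝ) ⊆ Set.Icc (-1 : ℝ) 2 ×ˢ Set.Icc (-1 : ℝ) 2 :=
    Set.prod_mono (fun x hx => ⟨by linarith [hx.1], by linarith [hx.2]⟩)
      (Set.Icc_subset_Icc (by norm_num) (by linarith))
  refine (lintegral_slab_le hp hρ hκ hι measurable_const
    (fun x => ⟨le_rfl, zero_le_one⟩) hS).trans ?_
  have hvol : volume (slabBox (1 / invScale N 0 : ℝ)) ≤ 1 := by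
    rw [slabBox, Measure.volume_eq_prod, Measure.prod_prod, Real.volume_Ioc, Real.volume_Icc]
    simpa using h2
  -- At `j = 0` the exponential is 1 and the right side equals 1.
  have hle : (1 : ℝ) ≤ 1 / invScale N 0 *
      ((invScale N 0 + 1) * Real.exp (2 - 2 / 2 ^ 0) - 1) := by
    norm_num
    field_simp
    exact le_rfl
  calc ENNReal.ofReal κ * volume (slabBox (1 / invScale N 0 : ℝ)) ^ (1 - 1 / p)
      ≤ ENNReal.ofReal κ * 1 := by
        gcongr
        refine ENNReal.rpow_le_one hvol ?_
        rw [sub_nonneg, div_le_one (by linarith)]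
        exact hp.le
    _ ≤ _ := by
        rw [mul_one]
        refine ENNReal.ofReal_le_ofReal ?_
        rw [mul_left_comm]
        nlinarith

theorem stage_factor_le {N : ℕ} (hN : 5 ≤ N) (j : ℕ) :
    (1 + 1 / 2 ^ (j + 2)) * ((1 / (invScale N j : ℝ)) /
      (1 / (invScale N j : ℝ) - 1 / (invScale N j : ℝ) ^ 2)) ≤ 1 + 1 / 2 ^ j := by
  have hbig := two_pow_le_invScale hN j
  set n : ℝ := (invScale N j : ℝ) with hn
  set t : ℝ := 1 / 2 ^ j with ht
  have ht0 : 0 < t := by positivity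
  have ht1 : t ≤ 1 := by
    rw [ht, div_le_one (by positivity)]
    exact one_le_pow₀ (by norm_num)
  have hnt : 32 ≤ n * t := by
    rw [ht, mul_one_div, le_div_iff₀ (by positivity)]
    rw [pow_add] at hbig
    linarith
  have hn32 : 32 ≤ n := by nlinarith
  have h1 : 1 / n / (1 / n - 1 / n ^ 2) = n / (n - 1) := by
    have : n - 1 ≠ 0 := by linarith
    field_simp
  have h2 : (1 : ℝ) / 2 ^ (j + 2) = t / 4 := by
    rw [ht, pow_add]
    field_simp
    norm_num
  rw [h1, h2, ← mul_div_assoc, div_le_iff₀ (by linarith)]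
  nlinarith

/-- The parameters are `h = n⁻²`, `a = 1/n - n⁻²`, `η = 2^(-(j+2))` and `m = n/2^(j+3)`. The added
slope `4am ≤ 2^(-(j+1))` is what the Lipschitz budget `1 - 2⁻ʲ` gains at the next stage. -/
theorem IsStage.exists_succ {p κ : ℝ} (hp : 3 < p) (hκ0 : 0 < κ) {ρ : Plane → ℝ≥0∞}
    (hρ : Measurable ρ) (hκ : HasLocalLpBound p κ ρ) {N : ℕ} (hN : 5 ≤ N)
    (hscale : ∀ j : ℕ, (3904 * N * 2 ^ (4 * j) : ℝ) ≤ (invScale N j : ℝ) ^ (1 - 3 / p)) {j : ℕ}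
    {f : ℝ → ℝ} (hf : IsStage ρ κ N j f) :
    ∃ f' : ℝ → ℝ, IsStage ρ κ N (j + 1) f' ∧
      ∀ x, f' x ∈ Set.Icc (f x) (f x + (1 / invScale N j - 1 / invScale N (j + 1))) := by
  have hbig := two_pow_le_invScale hN j
  have hcm := cellCount_mul hN j
  have hfac := stage_factor_le hN j
  have herr := error_le hp hN hscale j
  have hsucc : (invScale N (j + 1) : ℝ) = (invScale N j : ℝ) ^ 2 := by
    exact_mod_cast invScale_succ N j
  have hmem := hf.mem
  have hbound := hf.bound
  set n := invScale N j with hn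
  set m := cellCount N j with hm
  have h32 : (32 : ℝ) ≤ n := by
    refine le_trans ?_ hbig
    rw [pow_add]
    have : (1 : ℝ) ≤ 2 ^ j := one_le_pow₀ (by norm_num)
    linarith
  have h32' : 32 ≤ n := by exact_mod_cast h32
  have hn0 : (0 : ℝ) < n := by linarith
  set a : ℝ := 1 / n - 1 / (n : ℝ) ^ 2 with ha
  have ha0 : 0 < a := by
    rw [ha, sub_pos]
    exact one_div_lt_one_div_of_lt hn0 (by nlinarith)
  have hsq0 : 0 < 1 / (n : ℝ) ^ 2 := by positivity
  have hah : a + 1 / (n : ℝ) ^ 2 = 1 / n := by rw [ha]; ring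
  have h4am : 4 * a * m ≤ 1 / 2 ^ (j + 1) := by
    have h1 : a ≤ 1 / n := by linarith
    calc 4 * a * m ≤ 4 * (1 / n) * m := by gcongr
      _ = 1 / 2 ^ (j + 1) := by
        rw [← hcm]
        have hm0 : (m : ℝ) ≠ 0 := by
          intro h0
          rw [h0, zero_mul] at hcm
          linarith
        field_simp
        ring
  have hhalf : (1 : ℝ) / 2 ^ j = 1 / 2 ^ (j + 1) + 1 / 2 ^ (j + 1) := by
    rw [pow_succ]
    field_simp
    norm_num
  have hL' : 1 - 1 / 2 ^ j + 4 * a * m ≤ 1 - 1 / 2 ^ (j + 1) := by linarith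
  have hpos : (0 : ℝ) < 1 / 2 ^ (j + 1) := by positivity
  set B : ℝ := (invScale N 0 + 1) * Real.exp (2 - 2 / 2 ^ j) - 1 with hB
  have hexp1 : (1 : ℝ) ≤ Real.exp (2 - 2 / 2 ^ j) := by
    refine Real.one_le_exp ?_
    rw [sub_nonneg, div_le_iff₀ (by positivity)]
    have : (1 : ℝ) ≤ 2 ^ j := one_le_pow₀ (by norm_num)
    linarith
  have hB0 : 0 ≤ B := by
    have : (0 : ℝ) ≤ invScale N 0 := Nat.cast_nonneg _
    nlinarith
  rw [← hah] at hbound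
  have hη1 : (1 : ℝ) / 2 ^ (j + 2) ≤ 1 := by
    rw [div_le_one (by positivity)]
    exact one_le_pow₀ (by norm_num)
  have hsqle : 1 / (n : ℝ) ^ 2 ≤ 1 := by
    rw [div_le_one (by positivity)]
    exact one_le_pow₀ (by linarith)
  have h72 : 72 ≤ 216 * n ^ 8 := by
    have : 1 ≤ n ^ 8 := Nat.one_le_pow _ _ (by omega)
    omega
  obtain ⟨f', hlip, hmem', hb'⟩ := exists_perturbation_hasSlabBound (by linarith) hκ0 hρ hκ
    hf.lipschitz ha0 (fun x => ⟨(hmem x).1, (hmem x).2.trans (by linarith)⟩) hsq0 hsqle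
    (by positivity : (0 : ℝ) < 1 / 2 ^ (j + 2)) hη1 (m := m) (by rw [hm, cellCount]; positivity)
    (by linarith) h72 (by positivity) hbound
  refine ⟨f', ⟨fun x y => (hlip x y).trans (mul_le_mul_of_nonneg_right hL' (abs_nonneg _)),
    fun x => ⟨(hmem x).1.trans (hmem' x).1, ?_⟩, fun ι hι => ?_⟩, fun x => ?_⟩
  · rw [hsucc]
    linarith [(hmem' x).2, (hmem x).2]
  · rw [hsucc]
    refine (hb' ι hι).trans (ENNReal.ofReal_le_ofReal ?_)
    refine mul_le_mul_of_nonneg_left ?_ hsq0.le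
    rw [hah]
    -- The recursion multiplies `B + 1` by `1 + 2⁻ʲ ≤ exp(2⁻ʲ)`, and `2 - 2/2^j` is the sum of the
    -- earlier exponents.
    have hstep : (1 + 1 / 2 ^ j) * B + 1 / 2 ^ j ≤
        (invScale N 0 + 1) * Real.exp (2 - 2 / 2 ^ (j + 1)) - 1 := by
      have e1 : (2 : ℝ) - 2 / 2 ^ (j + 1) = (2 - 2 / 2 ^ j) + 1 / 2 ^ j := by
        rw [pow_succ]
        field_simp
        ring
      have e2 := Real.add_one_le_exp ((1 : ℝ) / 2 ^ j)
      have e3 : (1 + 1 / 2 ^ j) * ((invScale N 0 + 1) * Real.exp (2 - 2 / 2 ^ j)) ≤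
          Real.exp (1 / 2 ^ j) * ((invScale N 0 + 1) * Real.exp (2 - 2 / 2 ^ j)) := by
        gcongr
        linarith
      rw [e1, Real.exp_add, hB]
      linarith
    refine le_trans ?_ (mul_le_mul_of_nonneg_left hstep hκ0.le)
    have e4 := mul_le_mul_of_nonneg_right hfac (mul_nonneg hκ0.le hB0)
    have e5 := mul_le_mul_of_nonneg_left herr hκ0.le
    linarith
  · rw [hsucc]
    exact hmem' x

theorem tendsto_inv_invScale {N : ℕ} (hN : 5 ≤ N) :
    Filter.Tendsto (fun j => (1 : ℝ) / invScale N j) Filter.atTop (nhds 0) := by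
  have h : Filter.Tendsto (fun j : ℕ => ((1 : ℝ) / 2) ^ j) Filter.atTop (nhds 0) :=
    tendsto_pow_atTop_nhds_zero_of_lt_one (by norm_num) (by norm_num)
  refine squeeze_zero (fun j => by positivity) (fun j => ?_) h
  rw [one_div_pow]
  refine one_div_le_one_div_of_le (by positivity) (le_trans ?_ (two_pow_le_invScale hN j))
  exact pow_le_pow_right₀ (by norm_num) (by omega)

/-- The stages converge to a Lipschitz graph that stays in the neighbourhoods used at each stage. -/
theorem exists_limit_of_stages {p κ : ℝ} (hp : 3 < p) (hκ0 : 0 < κ) {ρ : Plane → ℝ≥0∞}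
    (hρ : Measurable ρ) (hκ : HasLocalLpBound p κ ρ) {N : ℕ} (hN : 5 ≤ N)
    (hscale : ∀ j : ℕ, (3904 * N * 2 ^ (4 * j) : ℝ) ≤ (invScale N j : ℝ) ^ (1 - 3 / p)) :
    ∃ (F : ℕ → ℝ → ℝ) (f : ℝ → ℝ), (∀ j, IsStage ρ κ N j (F j)) ∧ LipschitzWith 1 f ∧
      (∀ x, f x ∈ Set.Icc (0 : ℝ) 1) ∧
      ∀ j x, f x ∈ Set.Icc (F j x) (F j x + 1 / invScale N j) := by
  have hstep : ∀ j (f : {f // IsStage ρ κ N j f}), ∃ f' : {f // IsStage ρ κ N (j + 1) f},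
      ∀ x, f'.1 x ∈ Set.Icc (f.1 x) (f.1 x + (1 / invScale N j - 1 / invScale N (j + 1))) :=
    fun j f => by
      obtain ⟨f', h1, h2⟩ := f.2.exists_succ hp hκ0 hρ hκ hN hscale
      exact ⟨⟨f', h1⟩, h2⟩
  choose next hnext using hstep
  set G : ∀ j, {f // IsStage ρ κ N j f} := fun j =>
    Nat.rec ⟨0, isStage_zero (by linarith) hκ0 hρ hκ⟩ (fun j f => next j f) j with hG
  have hGsucc : ∀ j x, (G (j + 1)).1 x ∈ Set.Icc ((G j).1 x)
      ((G j).1 x + (1 / invScale N j - 1 / invScale N (j + 1))) := fun j x => hnext j (G j) x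
  -- The intervals from `G j` to `G j + 1/n` are nested, so the supremum lies in all of them.
  have hmono : ∀ x, Monotone fun j => (G j).1 x := fun x =>
    monotone_nat_of_le_succ fun j => (hGsucc j x).1
  have hanti : ∀ x, Antitone fun j => (G j).1 x + 1 / invScale N j := fun x =>
    antitone_nat_of_succ_le fun j => by linarith [(hGsucc j x).2]
  have hle : ∀ x i j, (G i).1 x ≤ (G j).1 x + 1 / invScale N j := fun x i j => by
    have h0 : ∀ k, (0 : ℝ) ≤ 1 / invScale N k := fun k => by positivity
    rcases le_total i j with h | h
    · linarith [hmono x h, h0 j]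
    · linarith [hanti x h, h0 i]
  have hbdd : ∀ x, BddAbove (Set.range fun j => (G j).1 x) := fun x =>
    ⟨_, Set.forall_mem_range.2 fun i => hle x i 0⟩
  set f : ℝ → ℝ := fun x => ⨆ j, (G j).1 x with hf
  have hfj : ∀ j x, f x ∈ Set.Icc ((G j).1 x) ((G j).1 x + 1 / invScale N j) := fun j x =>
    ⟨le_ciSup (hbdd x) j, ciSup_le fun i => hle x i j⟩
  have htend : ∀ x, Filter.Tendsto (fun j => (G j).1 x) Filter.atTop (nhds (f x)) := fun x =>
    tendsto_atTop_ciSup (hmono x) (hbdd x)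
  refine ⟨fun j => (G j).1, f, fun j => (G j).2, ?_, fun x => ?_, hfj⟩
  · refine LipschitzWith.of_dist_le_mul fun x y => ?_
    rw [NNReal.coe_one, one_mul]
    refine le_of_tendsto ((htend x).dist (htend y)) (Filter.Eventually.of_forall fun j => ?_)
    rw [Real.dist_eq, Real.dist_eq]
    refine ((G j).2.lipschitz x y).trans (mul_le_of_le_one_left (abs_nonneg _) ?_)
    have : (0 : ℝ) ≤ 1 / 2 ^ j := by positivity
    linarith
  · have h0 := (G 0).2.mem x
    have h1 := hfj 0 x
    exact ⟨h0.1.trans h1.1, by linarith [h0.2, h1.2]⟩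

/-! ### Passage to the limit graph -/

/-- The intervals of averaging contain `y` and shrink to it, so `φ` eventually exceeds any level
below `φ y` on all of them. -/
theorem le_liminf_average {φ : ℝ → ℝ≥0∞} (hφ : LowerSemicontinuous φ) {y : ℝ} {F h : ℕ → ℝ}
    (hpos : ∀ j, 0 < h j) (hh : Filter.Tendsto h Filter.atTop (nhds 0))
    (hy : ∀ j, y ∈ Set.Icc (F j) (F j + h j)) :
    φ y ≤ Filter.liminf (fun j => ENNReal.ofReal (h j)⁻¹ * ∫⁻ u in Set.Icc 0 (h j), φ (F j + u))
      Filter.atTop := by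
  refine le_of_forall_lt fun c hc => ?_
  obtain ⟨c', hcc', hc'⟩ := exists_between hc
  refine hcc'.trans_le (Filter.le_liminf_of_le (by isBoundedDefault) ?_)
  obtain ⟨ε, hε, hball⟩ := Metric.eventually_nhds_iff.1 (hφ y c' hc')
  filter_upwards [hh.eventually_lt_const hε] with j hj
  have hle : ∀ u ∈ Set.Icc 0 (h j), c' ≤ φ (F j + u) := fun u hu => by
    refine (hball ?_).le
    rw [Real.dist_eq, abs_lt]
    exact ⟨by linarith [hu.1, (hy j).2], by linarith [hu.2, (hy j).1]⟩
  calc c' = ENNReal.ofReal (h j)⁻¹ * ∫⁻ u in Set.Icc 0 (h j), c' := by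
        rw [setLIntegral_const, Real.volume_Icc, sub_zero, mul_comm, mul_assoc,
          ← ENNReal.ofReal_mul (hpos j).le, mul_inv_cancel₀ (hpos j).ne', ENNReal.ofReal_one,
          mul_one]
    _ ≤ _ := by
        refine mul_le_mul_right ?_ _
        exact setLIntegral_mono' measurableSet_Icc hle

/-- For every lower semicontinuous `ρ` with small local `L^p` norm, some Lipschitz graph has
small `ρ`-mass in all normalised positions. -/
theorem exists_graph_lintegral_le {p : ℝ} (hp : 3 < p) :
    ∃ C : ℝ, 0 < C ∧ ∀ κ : ℝ, 0 < κ → ∀ ρ : Plane → ℝ≥0∞, LowerSemicontinuous ρ →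
      HasLocalLpBound p κ ρ → ∃ f : ℝ → ℝ, LipschitzWith 1 f ∧ (∀ x, f x ∈ Set.Icc (0 : ℝ) 1) ∧
        ∀ ι, IsNormalized ι →
          ∫⁻ x in Set.Ioc (0 : ℝ) 1, ρ (ι !₂[x, f x]) ≤ ENNReal.ofReal (κ * C) := by
  have hα : 0 < 1 - 3 / p := by
    rw [sub_pos, div_lt_one (by linarith)]
    exact hp
  obtain ⟨N, hN, hscale⟩ := exists_scale hα
  refine ⟨(invScale N 0 + 1) * Real.exp 2, by positivity, fun κ hκ0 ρ hρ hκ => ?_⟩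
  have hρm := hρ.measurable
  obtain ⟨F, f, hF, hlip, h01, hfF⟩ := exists_limit_of_stages hp hκ0 hρm hκ hN hscale
  refine ⟨f, hlip, h01, fun ι hι => ?_⟩
  have hnpos : ∀ j, (0 : ℝ) < 1 / invScale N j := fun j => by
    have := (two_pow_le_invScale hN j)
    have h2 : (0 : ℝ) < 2 ^ (j + 5) := by positivity
    exact one_div_pos.2 (h2.trans_le this)
  have hFm : ∀ j, Measurable (F j) := fun j => by
    have : LipschitzWith 1 (F j) := LipschitzWith.of_dist_le_mul fun x y => by
      rw [Real.dist_eq, Real.dist_eq, NNReal.coe_one, one_mul]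
      refine ((hF j).lipschitz x y).trans (mul_le_of_le_one_left (abs_nonneg _) ?_)
      have : (0 : ℝ) ≤ 1 / 2 ^ j := by positivity
      linarith
    exact this.continuous.measurable
  have hφm : ∀ j, Measurable fun z : ℝ × ℝ => ρ (ι !₂[z.1, F j z.1 + z.2]) := fun j =>
    hρm.comp (measurePreserving_slab ι (hFm j)).measurable
  have hAm : ∀ j, Measurable fun x : ℝ => ∫⁻ u in Set.Icc 0 (1 / invScale N j : ℝ),
      ρ (ι !₂[x, F j x + u]) := fun j => (hφm j).lintegral_prod_right'
  have hlsc : ∀ x : ℝ, LowerSemicontinuous fun v : ℝ => ρ (ι !₂[x, v]) := fun x =>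
    hρ.comp (f := ρ) (g := fun v : ℝ => ι !₂[x, v])
      (ι.continuous.comp (by fun_prop))
  calc ∫⁻ x in Set.Ioc (0 : ℝ) 1, ρ (ι !₂[x, f x])
      ≤ ∫⁻ x in Set.Ioc (0 : ℝ) 1, Filter.liminf (fun j => ENNReal.ofReal (1 / invScale N j : ℝ)⁻¹ *
          ∫⁻ u in Set.Icc 0 (1 / invScale N j : ℝ), ρ (ι !₂[x, F j x + u])) Filter.atTop :=
        lintegral_mono fun x => le_liminf_average (hlsc x) (F := fun j => F j x) hnpos
          (tendsto_inv_invScale hN) (fun j => hfF j x)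
    _ ≤ Filter.liminf (fun j => ∫⁻ x in Set.Ioc (0 : ℝ) 1, ENNReal.ofReal (1 / invScale N j : ℝ)⁻¹ *
          ∫⁻ u in Set.Icc 0 (1 / invScale N j : ℝ), ρ (ι !₂[x, F j x + u])) Filter.atTop :=
        -- Fatou.
        lintegral_liminf_le fun j => (hAm j).const_mul _
    _ ≤ ENNReal.ofReal (κ * ((invScale N 0 + 1) * Real.exp 2)) := by
        refine Filter.liminf_le_of_le (by isBoundedDefault) fun b hb => ?_
        obtain ⟨j, hj⟩ := hb.exists
        refine hj.trans ?_
        rw [lintegral_const_mul _ (hAm j), ← lintegral_slabBox_eq hρm ι (hFm j)]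
        refine (mul_le_mul_right ((hF j).bound ι hι) _).trans ?_
        rw [← ENNReal.ofReal_mul (inv_nonneg.2 (hnpos j).le), ← mul_assoc,
          inv_mul_cancel₀ (hnpos j).ne', one_mul]
        refine ENNReal.ofReal_le_ofReal (mul_le_mul_of_nonneg_left ?_ hκ0.le)
        have h1 : Real.exp (2 - 2 / 2 ^ j) ≤ Real.exp 2 := by
          refine Real.exp_le_exp.2 ?_
          have : (0 : ℝ) ≤ 2 / 2 ^ j := by positivity
          linarith
        have h2 : ((invScale N 0 : ℝ) + 1) * Real.exp (2 - 2 / 2 ^ j) ≤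
            (invScale N 0 + 1) * Real.exp 2 := by gcongr
        linarith

/-! ### Reduction to periodic lower semicontinuous densities -/

/-- The integer lattice in the plane. -/
noncomputable def latticePoint (n : ℤ × ℤ) : Plane := !₂[(n.1 : ℝ), (n.2 : ℝ)]

theorem latticePoint_add (k n : ℤ × ℤ) :
    latticePoint (k + n) = latticePoint k + latticePoint n := by
  ext i
  fin_cases i <;> simp [latticePoint]

theorem card_int_Icc_ceil_floor_le (t : ℝ) : (Finset.Icc ⌈t - 10⌉ ⌊t + 10⌋).card ≤ 21 := by
  rw [Int.card_Icc]
  have h1 := Int.floor_le (t + 10)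
  have h2 := Int.le_ceil (t - 10)
  have h3 : ((⌊t + 10⌋ - ⌈t - 10⌉ : ℤ) : ℝ) ≤ (20 : ℤ) := by
    push_cast
    linarith
  have h4 := Int.cast_le.1 h3
  omega

theorem tsum_indicator_ball_le (y : Plane) :
    ∑' n : ℤ × ℤ, (Metric.ball (0 : Plane) 10).indicator (1 : Plane → ℝ≥0∞) (y - latticePoint n) ≤
      441 := by
  set A := Finset.Icc ⌈y 0 - 10⌉ ⌊y 0 + 10⌋ ×ˢ Finset.Icc ⌈y 1 - 10⌉ ⌊y 1 + 10⌋ with hA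
  have hzero : ∀ n ∉ A, (Metric.ball (0 : Plane) 10).indicator (1 : Plane → ℝ≥0∞)
      (y - latticePoint n) = 0 := by
    intro n hn
    refine Set.indicator_of_notMem (fun hmem => hn ?_) _
    rw [mem_ball_zero_iff] at hmem
    have h0 := abs_le.1 ((plane_abs_coord_le _ 0).trans hmem.le)
    have h1 := abs_le.1 ((plane_abs_coord_le _ 1).trans hmem.le)
    simp only [latticePoint, PiLp.sub_apply, Matrix.cons_val_zero, Matrix.cons_val_one] at h0 h1
    rw [hA, Finset.mem_product, Finset.mem_Icc, Finset.mem_Icc]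
    exact ⟨⟨Int.ceil_le.2 (by linarith), Int.le_floor.2 (by linarith)⟩,
      Int.ceil_le.2 (by linarith), Int.le_floor.2 (by linarith)⟩
  rw [tsum_eq_sum hzero]
  calc ∑ n ∈ A, (Metric.ball (0 : Plane) 10).indicator (1 : Plane → ℝ≥0∞) (y - latticePoint n)
      ≤ ∑ n ∈ A, (1 : ℝ≥0∞) := Finset.sum_le_sum fun n _ =>
        Set.indicator_le_self _ (1 : Plane → ℝ≥0∞) _
    _ = (A.card : ℝ≥0∞) := by simp
    _ ≤ ((441 : ℕ) : ℝ≥0∞) := by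
        rw [hA, Finset.card_product]
        exact_mod_cast Nat.mul_le_mul (card_int_Icc_ceil_floor_le (y 0))
          (card_int_Icc_ceil_floor_le (y 1))
    _ = 441 := by norm_num

theorem setLIntegral_ball_tsum_le {σ : Plane → ℝ≥0∞} (hσ : Measurable σ) :
    ∫⁻ x in Metric.ball (0 : Plane) 10, ∑' n, σ (x + latticePoint n) ≤ 441 * ∫⁻ x, σ x := by
  have hm : ∀ n, Measurable fun x => σ (x + latticePoint n) := fun n => by fun_prop
  have hb : Measurable ((Metric.ball (0 : Plane) 10).indicator (1 : Plane → ℝ≥0∞)) :=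
    measurable_one.indicator measurableSet_ball
  have hshift : ∀ n, ∫⁻ x in Metric.ball (0 : Plane) 10, σ (x + latticePoint n) =
      ∫⁻ y, (Metric.ball (0 : Plane) 10).indicator 1 (y - latticePoint n) * σ y := by
    intro n
    rw [← lintegral_indicator measurableSet_ball, ← lintegral_add_right_eq_self
      (fun y => (Metric.ball (0 : Plane) 10).indicator 1 (y - latticePoint n) * σ y)
      (latticePoint n)]
    refine lintegral_congr fun x => ?_
    rw [add_sub_cancel_right]
    by_cases hx : x ∈ Metric.ball (0 : Plane) 10 <;> simp [hx, Set.indicator]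
  rw [lintegral_tsum fun n => (hm n).aemeasurable]
  simp_rw [hshift]
  rw [← lintegral_tsum fun n => by fun_prop, ← lintegral_const_mul _ hσ]
  refine lintegral_mono fun y => ?_
  rw [ENNReal.tsum_mul_right]
  gcongr
  exact tsum_indicator_ball_le y

/-- Every density of small `L^p` norm is dominated by a lower semicontinuous, lattice periodic one
that is locally of small `L^p` norm. -/
theorem exists_periodic_majorant {p : ℝ} (hp : 0 < p) {ρ : Plane → ℝ≥0∞} (hρ : Measurable ρ)
    {ε : ℝ≥0∞} (hε : ∫⁻ x, ρ x ^ p < ε) :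
    ∃ ρ' : Plane → ℝ≥0∞, (∀ x, ρ x ≤ ρ' x) ∧ LowerSemicontinuous ρ' ∧
      (∀ x n, ρ' (x + latticePoint n) = ρ' x) ∧
      ∫⁻ x in Metric.ball (0 : Plane) 10, ρ' x ^ p ≤ 441 * ε := by
  have hpos : ε - ∫⁻ x, ρ x ^ p ≠ 0 := (tsub_pos_of_lt hε).ne'
  -- Vitali–Carathéodory for `ρ^p`. Its majorant is summed over lattice translates before the `p`-th
  -- root; at most `441 = 21²` translates of a point meet the disc.
  obtain ⟨σ, hσρ, hσ, hσint⟩ := exists_le_lowerSemicontinuous_lintegral_ge volume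
    (fun x => ρ x ^ p) (hρ.pow_const p) hpos
  rw [add_tsub_cancel_of_le hε.le] at hσint
  have hpow : ∀ t : ℝ≥0∞, (t ^ (1 / p)) ^ p = t := fun t => by
    rw [← ENNReal.rpow_mul, one_div_mul_cancel hp.ne', ENNReal.rpow_one]
  refine ⟨fun x => (∑' n, σ (x + latticePoint n)) ^ (1 / p), fun x => ?_, ?_, fun x k => ?_, ?_⟩
  · rw [← ENNReal.rpow_le_rpow_iff hp, hpow]
    refine (hσρ x).trans ?_
    refine le_trans (le_of_eq ?_) (ENNReal.le_tsum (0 : ℤ × ℤ))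
    congr 1
    ext i
    fin_cases i <;> simp [latticePoint]
  · have h1 : LowerSemicontinuous fun x => ∑' n, σ (x + latticePoint n) :=
      lowerSemicontinuous_tsum fun n => hσ.comp (by fun_prop)
    exact (ENNReal.continuous_rpow_const (y := 1 / p)).comp_lowerSemicontinuous h1
      (ENNReal.monotone_rpow_of_nonneg (by positivity))
  · have h : ∀ n, x + latticePoint k + latticePoint n = x + latticePoint (k + n) := fun n => by
      rw [add_assoc, ← latticePoint_add]
    simp only [h]
    congr 1
    exact (Equiv.addLeft k).tsum_eq (fun n => σ (x + latticePoint n))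
  · simp_rw [hpow]
    refine (setLIntegral_ball_tsum_le hσ.measurable).trans ?_
    gcongr

theorem exists_normalized (ι : Plane ≃ᵢ Plane) :
    ∃ ι' : Plane ≃ᵢ Plane, IsNormalized ι' ∧ ∃ n, ∀ z, ι z = ι' z + latticePoint n := by
  set n : ℤ × ℤ := (⌊ι 0 0⌋, ⌊ι 0 1⌋) with hn
  refine ⟨ι.trans (IsometryEquiv.addRight (-latticePoint n)), fun i => ?_, n, fun z => ?_⟩
  · have h : (ι.trans (IsometryEquiv.addRight (-latticePoint n))) 0 = ι 0 - latticePoint n := by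
      simp [sub_eq_add_neg]
    rw [h]
    fin_cases i
    · simp [latticePoint, hn, Int.fract_lt_one]
    · simp [latticePoint, hn, Int.fract_lt_one]
  · simp

theorem exists_graph_lintegral_lt {p : ℝ} (hp : 3 < p) :
    ∃ c : ℝ≥0, 0 < c ∧ ∀ ρ : Plane → ℝ≥0∞, Measurable ρ → ∫⁻ x, ρ x ^ p < c →
      ∃ f : ℝ → ℝ, LipschitzWith 1 f ∧ (∀ x, f x ∈ Set.Icc (0 : ℝ) 1) ∧
        ∀ ι : Plane ≃ᵢ Plane,
          ∫⁻ x in Set.Ioc (0 : ℝ) 1, ρ (ι !₂[x, f x]) ≤ ENNReal.ofReal (1 / 4) := by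
  obtain ⟨C, hC, hmain⟩ := exists_graph_lintegral_le hp
  have hp0 : 0 < p := by linarith
  set κ : ℝ := 1 / (4 * C) with hκ
  have hκ0 : 0 < κ := by positivity
  -- The 441 cancels the overlap of the periodisation, and `κ = 1/(4C)` turns the bound `κ C` into
  -- `1/4`.
  refine ⟨Real.toNNReal (κ ^ p / 441), Real.toNNReal_pos.2 (by positivity), fun ρ hρ hρc => ?_⟩
  obtain ⟨ρ', hle, hlsc, hper, hint⟩ := exists_periodic_majorant hp0 hρ hρc
  have hloc : HasLocalLpBound p κ ρ' := by
    rw [HasLocalLpBound]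
    calc _ ≤ (ENNReal.ofReal (κ ^ p)) ^ (1 / p) := by
          refine ENNReal.rpow_le_rpow (hint.trans_eq ?_) (by positivity)
          change 441 * ENNReal.ofReal (κ ^ p / 441) = _
          rw [show (441 : ℝ≥0∞) = ENNReal.ofReal 441 by norm_num,
            ← ENNReal.ofReal_mul (by norm_num)]
          congr 1
          ring
      _ = ENNReal.ofReal κ := by
          rw [← ENNReal.ofReal_rpow_of_pos hκ0, ← ENNReal.rpow_mul, mul_one_div_cancel hp0.ne',
            ENNReal.rpow_one]
  obtain ⟨f, hf, h01, hbound⟩ := hmain κ hκ0 ρ' hlsc hloc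
  refine ⟨f, hf, h01, fun ι => ?_⟩
  obtain ⟨ι', hι', n, hn⟩ := exists_normalized ι
  calc ∫⁻ x in Set.Ioc (0 : ℝ) 1, ρ (ι !₂[x, f x])
      ≤ ∫⁻ x in Set.Ioc (0 : ℝ) 1, ρ' (ι' !₂[x, f x]) := lintegral_mono fun x => by
        rw [← hper _ n, ← hn]
        exact hle _
    _ ≤ ENNReal.ofReal (κ * C) := hbound ι' hι'
    _ = _ := by
        congr 1
        rw [hκ]
        field_simp

/-! ### From graphs to curves, and the conclusion -/

/-- The parametrization of the graph of `f`. -/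
noncomputable def graphMap (f : ℝ → ℝ) (x : ℝ) : Plane := !₂[x, f x]

theorem lipschitzWith_graphMap {f : ℝ → ℝ} (hf : LipschitzWith 1 f) :
    LipschitzWith 2 (graphMap f) := by
  refine LipschitzWith.of_dist_le_mul fun x y => ?_
  rw [dist_eq_norm]
  refine (plane_norm_le _).trans ?_
  have h := hf.dist_le_mul x y
  rw [NNReal.coe_one, one_mul, Real.dist_eq, Real.dist_eq] at h
  simp only [graphMap, PiLp.sub_apply, Matrix.cons_val_zero, Matrix.cons_val_one]
  rw [Real.dist_eq]
  push_cast
  linarith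

theorem edist_le_edist_graphMap (f : ℝ → ℝ) (x y : ℝ) :
    edist x y ≤ edist (graphMap f x) (graphMap f y) := by
  rw [edist_dist, edist_dist]
  refine ENNReal.ofReal_le_ofReal ?_
  rw [dist_eq_norm (graphMap f x), Real.dist_eq]
  simpa [graphMap] using plane_abs_coord_le (graphMap f x - graphMap f y) 0

theorem LipschitzWith.eVariationOn_Icc_le {X : Type*} [PseudoEMetricSpace X] {F : ℝ → X} {K : ℝ≥0}
    (hF : LipschitzWith K F) (a b : ℝ) :
    eVariationOn F (Set.Icc a b) ≤ K * ENNReal.ofReal (b - a) := by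
  rcases le_total a b with hab | hab
  · have h1 := (hF.lipschitzOnWith (s := Set.univ)).comp_eVariationOn_le (g := id)
      (Set.mapsTo_univ _ (Set.Icc a b))
    have h2 := (monotone_id.monotoneOn (Set.Icc a b)).eVariationOn_eq (Set.left_mem_Icc.2 hab)
      (Set.right_mem_Icc.2 hab)
    rw [Set.inter_self] at h2
    exact h1.trans (mul_le_mul_right h2.le _)
  · rw [eVariationOn.subsingleton]
    · exact zero_le
    · exact Set.subsingleton_Icc_of_ge hab

theorem LipschitzWith.isLocallyRectifiableCurve_image {F : ℝ → Plane} {K : ℝ≥0}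
    (hF : LipschitzWith K F) : IsLocallyRectifiableCurve (F '' Set.Icc 0 1) :=
  ⟨Set.Icc 0 1, F, Set.ordConnected_Icc, ⟨0, by simp, 1, by simp, zero_ne_one⟩,
    hF.continuous.continuousOn, hF.locallyBoundedVariationOn _, rfl⟩

/-- The graph of a Lipschitz function over the unit interval has an initial arc of length one. -/
theorem exists_arc_of_length_one {f : ℝ → ℝ} (hf : LipschitzWith 1 f) :
    ∃ t ∈ Set.Icc (0 : ℝ) 1, eVariationOn (graphMap f) (Set.Icc 0 t) = 1 := by
  have hF := lipschitzWith_graphMap hf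
  have hloc : LocallyBoundedVariationOn (graphMap f) Set.univ := hF.locallyBoundedVariationOn _
  set v : ℝ → ℝ := fun t => variationOnFromTo (graphMap f) Set.univ 0 t with hv
  have hfin : ∀ a b, eVariationOn (graphMap f) (Set.Icc a b) ≠ ∞ := fun a b =>
    ne_top_of_le_ne_top (by finiteness) (hF.eVariationOn_Icc_le a b)
  have heq : ∀ s t, s ≤ t → variationOnFromTo (graphMap f) Set.univ s t =
      (eVariationOn (graphMap f) (Set.Icc s t)).toReal := fun s t hst => by
    rw [variationOnFromTo.eq_of_le _ _ hst, Set.univ_inter]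
  have hdist : ∀ s t, s ≤ t → dist (v s) (v t) ≤ 2 * dist s t := fun s t hst => by
    have h1 := variationOnFromTo.add hloc (Set.mem_univ 0) (Set.mem_univ s) (Set.mem_univ t)
    have h2 : v t - v s = (eVariationOn (graphMap f) (Set.Icc s t)).toReal := by
      rw [← heq s t hst]
      simp only [hv]
      linarith
    rw [dist_comm, dist_comm s, Real.dist_eq, Real.dist_eq, h2, abs_of_nonneg ENNReal.toReal_nonneg,
      abs_of_nonneg (sub_nonneg.2 hst)]
    refine ENNReal.toReal_le_of_le_ofReal (by linarith) ((hF.eVariationOn_Icc_le s t).trans_eq ?_)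
    rw [ENNReal.ofReal_mul (by norm_num)]
    norm_num
  have hcont : Continuous v := by
    have : LipschitzWith 2 v := LipschitzWith.of_dist_le_mul fun s t => by
      rcases le_total s t with h | h
      · exact hdist s t h
      · rw [dist_comm, dist_comm s]
        exact hdist t s h
    exact this.continuous
  have hv0 : v 0 = 0 := variationOnFromTo.self _ _ _
  have hv1 : 1 ≤ v 1 := by
    -- The endpoints are already at horizontal distance 1.
    have h1 : (1 : ℝ≥0∞) ≤ eVariationOn (graphMap f) (Set.Icc 0 1) := by
      refine le_trans ?_ (eVariationOn.edist_le (graphMap f) (Set.right_mem_Icc.2 zero_le_one)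
        (Set.left_mem_Icc.2 zero_le_one))
      refine le_trans ?_ (edist_le_edist_graphMap f 1 0)
      simp [edist_dist]
    have h2 := ENNReal.toReal_mono (hfin 0 1) h1
    rw [← heq 0 1 zero_le_one, ENNReal.toReal_one] at h2
    exact h2
  obtain ⟨t, ht, hvt⟩ := intermediate_value_Icc (zero_le_one (α := ℝ)) hcont.continuousOn
    (show (1 : ℝ) ∈ Set.Icc (v 0) (v 1) from ⟨by rw [hv0]; norm_num, hv1⟩)
  refine ⟨t, ht, ?_⟩
  rw [← ENNReal.toReal_eq_one_iff, ← heq 0 t ht.1]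
  exact hvt

/-- For Moser families: the graph may be longer than one, but an upper bound for its `ρ`-integral
passes to a subarc of length exactly one. -/
theorem exists_curveOfLengthOne_subset_graph {f : ℝ → ℝ} (hf : LipschitzWith 1 f) :
    ∃ (F : ℝ → Plane) (K : ℝ≥0), LipschitzWith K F ∧ IsCurveOfLengthOne (F '' Set.Icc 0 1) ∧
      F '' Set.Icc 0 1 ⊆ graphMap f '' Set.Icc 0 1 := by
  obtain ⟨t, ht, hvar⟩ := exists_arc_of_length_one hf
  have hmul : LipschitzWith (Real.toNNReal t) fun s : ℝ => t * s :=
    LipschitzWith.of_dist_le_mul fun x y => by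
      rw [Real.dist_eq, Real.dist_eq, ← mul_sub, abs_mul, abs_of_nonneg ht.1,
        Real.coe_toNNReal t ht.1]
  have hF := (lipschitzWith_graphMap hf).comp hmul
  have himage : (fun s : ℝ => t * s) '' Set.Icc 0 1 = Set.Icc 0 t := by
    rw [Set.image_mul_left_Icc ht.1 zero_le_one, mul_zero, mul_one]
  refine ⟨_, _, hF, ⟨_, hF.continuous.continuousOn, ?_, rfl⟩, ?_⟩
  · rw [eVariationOn.comp_eq_of_monotoneOn _ _
      ((monotone_mul_left_of_nonneg ht.1).monotoneOn _), himage, hvar]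
  · rw [Set.image_comp, himage]
    exact Set.image_mono (Set.Icc_subset_Icc le_rfl ht.2)

/-- A `K`-Lipschitz map multiplies one-dimensional Hausdorff measure by at most `K`; applied to all
Borel sets, this is an inequality of measures, which can be integrated. -/
theorem LipschitzWith.setLIntegral_hausdorffMeasure_image_le {X : Type*} [MetricSpace X]
    [MeasurableSpace X] [BorelSpace X] {F : ℝ → X} {K : ℝ≥0} (hF : LipschitzWith K F) (s : Set ℝ)
    {ρ : X → ℝ≥0∞} (hρ : Measurable ρ) :
    ∫⁻ y in F '' s, ρ y ∂(Measure.hausdorffMeasure 1) ≤ K * ∫⁻ x in s, ρ (F x) := by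
  have hFm := hF.continuous.measurable
  have hle : (Measure.hausdorffMeasure 1 : Measure X).restrict (F '' s) ≤
      (K : ℝ≥0∞) • (volume.restrict s).map F := by
    refine Measure.le_iff.2 fun B hB => ?_
    rw [Measure.restrict_apply hB, Measure.smul_apply, Measure.map_apply hFm hB,
      Measure.restrict_apply (hFm hB), smul_eq_mul]
    have hsub : B ∩ F '' s ⊆ F '' (F ⁻¹' B ∩ s) := by
      rintro _ ⟨hy, x, hx, rfl⟩
      exact ⟨x, ⟨hy, hx⟩, rfl⟩
    refine (measure_mono hsub).trans ?_
    have := hF.hausdorffMeasure_image_le (d := 1) zero_le_one (F ⁻¹' B ∩ s)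
    rwa [hausdorffMeasure_real, ENNReal.rpow_one] at this
  calc _ ≤ ∫⁻ y, ρ y ∂((K : ℝ≥0∞) • (volume.restrict s).map F) := lintegral_mono' hle le_rfl
    _ = _ := by rw [lintegral_smul_measure, lintegral_map hρ hFm, smul_eq_mul]

/-- The parametrization is 2-Lipschitz, so the bound `1/4` gives at most `1/2`. -/
theorem not_one_le_setLIntegral {ρ : Plane → ℝ≥0∞} (hρ : Measurable ρ) {f : ℝ → ℝ}
    (hf : LipschitzWith 1 f) (ι : Plane ≃ᵢ Plane)
    (h : ∫⁻ x in Set.Ioc (0 : ℝ) 1, ρ (ι !₂[x, f x]) ≤ ENNReal.ofReal (1 / 4)) {γ : Set Plane}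
    (hγ : γ ⊆ graphMap f '' Set.Icc 0 1) :
    ¬ 1 ≤ ∫⁻ x in ι '' γ, ρ x ∂(Measure.hausdorffMeasure 1 : Measure Plane) := by
  rw [not_le]
  have hF : LipschitzWith (1 * 2) (ι ∘ graphMap f) :=
    ι.isometry.lipschitz.comp (lipschitzWith_graphMap hf)
  calc ∫⁻ x in ι '' γ, ρ x ∂(Measure.hausdorffMeasure 1 : Measure Plane)
      ≤ ∫⁻ x in (ι ∘ graphMap f) '' Set.Icc 0 1, ρ x ∂(Measure.hausdorffMeasure 1) := by
        refine lintegral_mono_set ?_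
        rw [Set.image_comp]
        exact Set.image_mono hγ
    _ ≤ ((1 * 2 : ℝ≥0) : ℝ≥0∞) * ∫⁻ x in Set.Icc (0 : ℝ) 1, ρ ((ι ∘ graphMap f) x) :=
        hF.setLIntegral_hausdorffMeasure_image_le _ hρ
    _ ≤ ((1 * 2 : ℝ≥0) : ℝ≥0∞) * ENNReal.ofReal (1 / 4) := by
        refine mul_le_mul_right ?_ _
        rw [setLIntegral_congr Ioc_ae_eq_Icc.symm]
        exact h
    _ = ENNReal.ofReal (1 / 2) := by
        rw [show ((1 * 2 : ℝ≥0) : ℝ≥0∞) = ENNReal.ofReal 2 by norm_num,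
          ← ENNReal.ofReal_mul (by norm_num)]
        norm_num
    _ < 1 := by
        rw [← ENNReal.ofReal_one, ENNReal.ofReal_lt_ofReal_iff one_pos]
        norm_num

theorem theorem1 (p : ℝ) (hp : 3 < p) :
    ∃ c : ℝ≥0, 0 < c ∧
      (∀ Γ : Set (Set Plane), (∀ γ ∈ Γ, IsCurve γ) →
        (∀ f : ℝ → ℝ, Set.MapsTo f (Set.Icc 0 1) (Set.Icc 0 1) →
          LipschitzOnWith 1 f (Set.Icc 0 1) →
          ContainsIsometricCopy Γ (graphOverUnitInterval f)) →
        (c : ℝ≥0∞) ≤ modulus p Γ) ∧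
      (∀ Γ : Set (Set Plane), IsMoserFamily Γ → (c : ℝ≥0∞) ≤ modulus p Γ) := by
  obtain ⟨c, hc, hmain⟩ := exists_graph_lintegral_lt hp
  refine ⟨c, hc, fun Γ _ hΓ => ?_, fun Γ hΓ => ?_⟩
  · refine le_iInf₂ fun ρ hρ => ?_
    by_contra! hlt
    obtain ⟨f, hf, h01, hbound⟩ := hmain ρ hρ.1 hlt
    obtain ⟨ι, hι⟩ := hΓ f (fun x _ => h01 x) hf.lipschitzOnWith
    refine not_one_le_setLIntegral hρ.1 hf ι (hbound ι) (γ := graphOverUnitInterval f) subset_rfl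
      (hρ.2 _ hι ?_)
    have := (ι.isometry.lipschitz.comp
      (lipschitzWith_graphMap hf)).isLocallyRectifiableCurve_image
    rwa [Set.image_comp] at this
  · refine le_iInf₂ fun ρ hρ => ?_
    by_contra! hlt
    obtain ⟨f, hf, h01, hbound⟩ := hmain ρ hρ.1 hlt
    obtain ⟨F, K, hF, hone, hsub⟩ := exists_curveOfLengthOne_subset_graph hf
    obtain ⟨ι, hι⟩ := hΓ.2 _ hone
    refine not_one_le_setLIntegral hρ.1 hf ι (hbound ι) hsub (hρ.2 _ hι ?_)
    have := (ι.isometry.lipschitz.comp hF).isLocallyRectifiableCurve_image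
    rwa [Set.image_comp] at this
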